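/- **Setting.** There are $n$ advertisers and $m\ge 1$ slots with effects $s_1>s_2>\dots>s_m>0$; put $s_k=0$ for $k>m$. Advertiser $i$ has a value per click $\theta_i\ge 0$ and a relevance $w_i>0$; displayed in slot $k$ it is clicked at rate $w_is_k$. The values are i.i.d. with cdf $F$ and density $f$, where $F(0)=0$ and $F(t)>0$ for all $t>0$, and are independent of the relevance vector $w=(w_1,\dots,w_n)$, which has an arbitrary joint law with $\mathbb E\,w_i<\infty$ and $\mathbb P(w_i\ne w_j\text{ for some }i,j)>0$. On $\{t>0: F(t)<1\}$ the hazard rate $f/(1-F)$ is non-decreasing and the virtual value $\phi(t)=t-\frac{1-F(t)}{f(t)}$ is differentiable. Given a ranking function $y(b,w)\ge 0$ and bids $b_i$, advertisers are sorted by decreasing score $y(b_i,w_i)$ (ties broken in any way), the one in position $k$ getting slot $k$; advertisers with score $0$ are excluded. Let $x_i$ be the effect of the slot of advertiser $i$ ($0$ if $i$ is not displayed), and let $q_k$ be the score of the advertiser in position $k+1$ ($0$ if there is none). The price per click of position $k$ for advertiser $i$ is $p_i(k)=\inf\{b: y(b,w_i)>q_k\}$. With $k_i$ the position of $i$, the outcome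 is a *symmetric Nash equilibrium* (SNE) if $$(\theta_i-p_i(k_i))\,x_i\ \ge\ (\theta_i-p_i(k))\,s_k\qquad\text{for all advertisers } i\text{ and all positions }k\ge 1$$ (vacant slots and the option of not being displayed included). Its revenue is $\sum_i p_i(k_i)w_ix_i$, and it is a *lowest* SNE if no SNE for the same $(\theta,w)$ has smaller revenue. A (measurable) rule that selects an SNE for almost every realisation $(\theta,w)$, with resulting allocation rule $x(\theta,w)$, *respects the bound* if its expected revenue is at most $R(x)=\mathbb E\bigl[\sum_i\phi(\theta_i)w_ix_i(\theta,w)\bigr]$. **Theorem.** Let $\phi(\bar\theta)=0$ and $r\in(0,\bar\theta]$, and suppose $$r\ \le\ \inf_{t\ge r,\ F(t)<1}\Bigl\{t-\frac{\phi(t)}{\phi'(t)}\Bigr\}.$$ Let $R_1$ be the expected revenue of a rule that selects SNE under the ranking function $(b-r)^+w$ and that either respects the bound or selects lowest SNE. Let $R_2$ be the expected revenue of a rule that selects SNE under the ranking function $\mathbf 1\{b\ge r\}\,bw$ and respects the bound. Then $R_1>R_2$. -/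

import Mathlib

open MeasureTheory

noncomputable section

namespace GSP

/-! ### Distribution of the values -/

/-- The law on `ℝ` with probability density `f`. -/
def valueLaw (f : ℝ → ℝ) : Measure ℝ :=
  volume.withDensity fun t => ENNReal.ofReal (f t)

/-- The cumulative distribution function `F` of the law with density `f`. -/
def valueCDF (f : ℝ → ℝ) (t : ℝ) : ℝ := ProbabilityTheory.cdf (valueLaw f) t

/-- The virtual value `φ(t) = t - (1 - F(t)) / f(t)`. -/
def virtualValue (f : ℝ → ℝ) (t : ℝ) : ℝ := t - (1 - valueCDF f t) / f t

/-- The positive points below the (possibly infinite) upper end of the range of the values. -/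
def valueRange (f : ℝ → ℝ) : Set ℝ := {t | 0 < t ∧ valueCDF f t < 1}

/-- `f` is a density of nonnegative values with support at zero, with non-decreasing hazard rate
and differentiable virtual value function. -/
structure IsRegularDensity (f : ℝ → ℝ) : Prop where
  measurable : Measurable f
  nonneg : ∀ t, 0 ≤ f t
  isProbabilityMeasure : IsProbabilityMeasure (valueLaw f)
  cdf_zero : valueCDF f 0 = 0
  support_at_zero : ∀ t, 0 < t → 0 < valueCDF f t
  hazard_monotone : MonotoneOn (fun t => f t / (1 - valueCDF f t)) (valueRange f)
  differentiable : DifferentiableOn ℝ (virtualValue f) (valueRange f)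

/-- A realisation `(θ, w)` of the values and of the relevances of `n` advertisers. -/
abbrev Types (n : ℕ) : Type := (Fin n → ℝ) × (Fin n → ℝ)

/-- The law of the types: values are i.i.d. with density `f`, and independent of the relevances,
whose joint law is `ν`. -/
def typeLaw {n : ℕ} (f : ℝ → ℝ) (ν : Measure (Fin n → ℝ)) : Measure (Types n) :=
  (Measure.pi fun _ => valueLaw f).prod ν

/-! ### Ranking functions and the generalised second price -/

/-- The ranking function `(b - r)⁺ w`. -/
def proposedRanking (r b w : ℝ) : ℝ := max (b - r) 0 * w

/-- The ranking function `𝟙{b ≥ r} b w`. -/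
def standardRanking (r b w : ℝ) : ℝ := if r ≤ b then b * w else 0

/-- The price per click of an advertiser with relevance `w` whose score has to exceed `q`. -/
def price (y : ℝ → ℝ → ℝ) (q w : ℝ) : ℝ := sInf {b | q < y b w}

/-- The effect of the `k`-th slot (counted from `0`); there is nothing beyond the last slot. -/
def slotEffect {m : ℕ} (s : Fin m → ℝ) (k : ℕ) : ℝ := if h : k < m then s ⟨k, h⟩ else 0

/-- An outcome of the auction: the bids, and the position of each advertiser in the ranking
(counted from `0`). -/
structure Outcome (n : ℕ) where
  bid : Fin n → ℝ
  rank : Equiv.Perm (Fin n)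

namespace Outcome

variable {n m : ℕ}

/-- The advertisers are sorted by their scores (ties may be broken in any way). -/
def IsSorted (y : ℝ → ℝ → ℝ) (w : Fin n → ℝ) (o : Outcome n) : Prop :=
  ∀ i j, o.rank i < o.rank j → y (o.bid j) (w j) ≤ y (o.bid i) (w i)

/-- The score of the advertiser in the position after the `k`-th, and `0` if there is none. -/
def nextScore (y : ℝ → ℝ → ℝ) (w : Fin n → ℝ) (o : Outcome n) (k : ℕ) : ℝ :=
  if h : k + 1 < n then
    y (o.bid (o.rank.symm ⟨k + 1, h⟩)) (w (o.rank.symm ⟨k + 1, h⟩))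
  else 0

/-- The allocation `x_i`: the effect of the slot of advertiser `i`. Advertisers with score `0` are
excluded. -/
def alloc (y : ℝ → ℝ → ℝ) (s : Fin m → ℝ) (w : Fin n → ℝ) (o : Outcome n) (i : Fin n) : ℝ :=
  if 0 < y (o.bid i) (w i) then slotEffect s (o.rank i) else 0

/-- What an advertiser with relevance `v` pays per click in position `k`. -/
def priceAt (y : ℝ → ℝ → ℝ) (w : Fin n → ℝ) (o : Outcome n) (k : ℕ) (v : ℝ) : ℝ :=
  price y (o.nextScore y w k) v

/-- Symmetric Nash equilibrium at the realisation `p = (θ, w)`: no advertiser prefers another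
position at the price that goes with that position. The positions include vacant slots, and those
beyond the last slot, which amount to not being displayed. -/
def IsSNE (y : ℝ → ℝ → ℝ) (s : Fin m → ℝ) (p : Types n) (o : Outcome n) : Prop :=
  o.IsSorted y p.2 ∧
    ∀ (i : Fin n) (k : ℕ),
      (p.1 i - o.priceAt y p.2 k (p.2 i)) * slotEffect s k ≤
        (p.1 i - o.priceAt y p.2 (o.rank i) (p.2 i)) * o.alloc y s p.2 i

/-- The revenue: advertiser `i` gets `w_i x_i` clicks in expectation. -/
def revenue (y : ℝ → ℝ → ℝ) (s : Fin m → ℝ) (w : Fin n → ℝ) (o : Outcome n) : ℝ :=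
  ∑ i, o.priceAt y w (o.rank i) (w i) * w i * o.alloc y s w i

/-- A symmetric Nash equilibrium whose revenue is the lowest among all of them. -/
def IsLowestSNE (y : ℝ → ℝ → ℝ) (s : Fin m → ℝ) (p : Types n) (o : Outcome n) : Prop :=
  o.IsSNE y s p ∧ ∀ o' : Outcome n, o'.IsSNE y s p → o.revenue y s p.2 ≤ o'.revenue y s p.2

end Outcome

/-! ### Rules that select an outcome for every realisation of the types -/

section Selection

variable {n m : ℕ}

/-- Measurability of a rule that selects an outcome for each realisation of the types. -/
def IsMeasurableRule (P : Measure (Types n)) (o : Types n → Outcome n) : Prop :=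
  ∀ i, AEMeasurable (fun p => (o p).bid i) P ∧ AEMeasurable (fun p => (o p).rank i) P

/-- The rule selects symmetric Nash equilibria. -/
def SelectsSNE (y : ℝ → ℝ → ℝ) (s : Fin m → ℝ) (P : Measure (Types n))
    (o : Types n → Outcome n) : Prop :=
  IsMeasurableRule P o ∧ ∀ᵐ p ∂P, (o p).IsSNE y s p

/-- The rule selects symmetric Nash equilibria of lowest revenue. -/
def SelectsLowestSNE (y : ℝ → ℝ → ℝ) (s : Fin m → ℝ) (P : Measure (Types n))
    (o : Types n → Outcome n) : Prop :=
  IsMeasurableRule P o ∧ ∀ᵐ p ∂P, (o p).IsLowestSNE y s p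

/-- The expected revenue of the rule. -/
def expectedRevenue (y : ℝ → ℝ → ℝ) (s : Fin m → ℝ) (P : Measure (Types n))
    (o : Types n → Outcome n) : ℝ :=
  ∫ p, (o p).revenue y s p.2 ∂P

/-- The expected virtual surplus `E[∑ φ(θ_i) w_i x_i(θ, w)]` of the allocation rule `x` that the
rule `o` defines. -/
def virtualSurplus (f : ℝ → ℝ) (y : ℝ → ℝ → ℝ) (s : Fin m → ℝ) (P : Measure (Types n))
    (o : Types n → Outcome n) : ℝ :=
  ∫ p, ∑ i, virtualValue f (p.1 i) * p.2 i * (o p).alloc y s p.2 i ∂P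

/-- The expected revenue does not exceed that of the optimal Bayes-Nash equilibrium with the same
allocation rule. -/
def RespectsBound (f : ℝ → ℝ) (y : ℝ → ℝ → ℝ) (s : Fin m → ℝ) (P : Measure (Types n))
    (o : Types n → Outcome n) : Prop :=
  expectedRevenue y s P o ≤ virtualSurplus f y s P o

end Selection

end GSP

end

open MeasureTheory

noncomputable section

namespace GSP

/-! ### Slot effects -/

section SlotEffect

variable {m : ℕ} {s : Fin m → ℝ}

/-! The proof is a chain: R₂ ≤ virtual surplus under the standard ranking < virtual surplus under
the proposed ranking ≤ R₁. The first link is the assumed bound.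

The strict link (`virtualSurplus_standard_lt_proposed`) is a comparison at each realisation. In
equilibrium the proposed ranking orders by (θ - r)w. If the rankings order i and j differently,
`IsSNE.standard_order` shows that the advertiser favoured by the proposed ranking is the less
relevant one. The condition on r says that φ(t)/(t - r) is non-decreasing, so that advertiser also
has the larger φ(θ)w (`virtualValue_mul_le_mul`). Summation by parts over the top sets turns these
pairwise comparisons into one of virtual surpluses (`sum_mul_rank_le`). It is strict on an open box
of values whenever two relevances differ (`not_ae_not_isReversal`).

The last link (`SelectsSNE.virtualSurplus_le_expectedRevenue`) holds for every equilibrium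
selection. Net of the reserve, an advertiser is worth v = (θ - r)⁺w per impression and pays the next
score. The conditions of no envy towards lower positions then bound its utility by the integral over
z from 0 to v of the effect of the slot that z would earn (`utility_le_integral_countAbove`). This
effect does not depend on the advertiser's own value, so resampling that value and applying Fubini
bounds the expected utility by E[(1 - F)/f · w x] (`lintegral_utility_le`). Revenue is surplus minus
utilities, hence at least the virtual surplus. -/

lemma slotEffect_of_le {k : ℕ} (h : m ≤ k) : slotEffect s k = 0 := by
  simp [slotEffect, not_lt.mpr h]

lemma slotEffect_nonneg (hs : ∀ k, 0 < s k) (k : ℕ) : 0 ≤ slotEffect s k := by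
  unfold slotEffect
  split_ifs with h
  · exact (hs _).le
  · exact le_rfl

lemma slotEffect_antitone (hs : StrictAnti s) (hs_pos : ∀ k, 0 < s k) :
    Antitone (slotEffect s) := by
  intro k l hkl
  by_cases hl : l < m
  · have hk : k < m := lt_of_le_of_lt hkl hl
    simp only [slotEffect, hl, hk, dif_pos]
    exact hs.antitone (by simpa using hkl)
  · rw [slotEffect_of_le (not_lt.mp hl)]
    exact slotEffect_nonneg hs_pos k

lemma slotEffect_lt (hs : StrictAnti s) {k l : ℕ} (hkl : k < l)
    (hk : 0 < slotEffect s k) : slotEffect s l < slotEffect s k := by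
  by_cases hl : l < m
  · have hk : k < m := hkl.trans hl
    simp only [slotEffect, hl, hk, dif_pos]
    exact hs (by simpa using hkl)
  · rwa [slotEffect_of_le (not_lt.mp hl)]

lemma slotEffect_zero_pos (hm : 0 < m) (hs_pos : ∀ k, 0 < s k) : 0 < slotEffect s 0 := by
  simp only [slotEffect, hm, dif_pos]
  exact hs_pos _

end SlotEffect

/-! ### Prices -/

/-- The reserve enters additively: the cost per impression is `r * w + q`. Subtracting `r` from the
values therefore leaves an auction without a reserve. -/
lemma price_proposedRanking {r q w : ℝ} (hq : 0 ≤ q) (hw : 0 < w) :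
    price (proposedRanking r) q w = r + q / w := by
  have : {b | q < proposedRanking r b w} = Set.Ioi (r + q / w) := by
    ext b
    simp only [Set.mem_ofPred_eq, Set.mem_Ioi, proposedRanking]
    rw [← div_lt_iff₀ hw, lt_max_iff]
    have : 0 ≤ q / w := by positivity
    constructor
    · rintro (h | h) <;> linarith
    · intro h; left; linarith
  rw [price, this, csInf_Ioi]

lemma price_standardRanking {r q w : ℝ} (hq : 0 ≤ q) (hw : 0 < w) :
    price (standardRanking r) q w = max r (q / w) := by
  have hset : {b | q < standardRanking r b w} = {b | r ≤ b ∧ q / w < b} := by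
    ext b
    simp only [Set.mem_ofPred_eq, standardRanking]
    rw [div_lt_iff₀ hw]
    split_ifs with h
    · simp [h]
    · simp [h, hq]
  rw [price, hset]
  rcases lt_or_ge (q / w) r with h | h
  · have : {b | r ≤ b ∧ q / w < b} = Set.Ici r := by
      ext b; simp only [Set.mem_ofPred_eq, Set.mem_Ici]
      exact ⟨fun h => h.1, fun hb => ⟨hb, h.trans_le hb⟩⟩
    rw [this, csInf_Ici, max_eq_left h.le]
  · have : {b | r ≤ b ∧ q / w < b} = Set.Ioi (q / w) := by
      ext b; simp only [Set.mem_ofPred_eq, Set.mem_Ioi]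
      exact ⟨fun h => h.2, fun hb => ⟨h.trans hb.le, hb⟩⟩
    rw [this, csInf_Ioi, max_eq_right h]

/-- The ranking function has nonnegative scores, and its prices have the reserve price `r`. -/
structure HasReservePrice (y : ℝ → ℝ → ℝ) (r : ℝ) : Prop where
  nonneg : ∀ {b w : ℝ}, 0 < w → 0 ≤ y b w
  price_zero : ∀ {w : ℝ}, 0 < w → price y 0 w = r
  le_price : ∀ {q w : ℝ}, 0 ≤ q → 0 < w → r ≤ price y q w

lemma hasReservePrice_proposedRanking (r : ℝ) : HasReservePrice (proposedRanking r) r where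
  nonneg hw := mul_nonneg (le_max_right _ _) hw.le
  price_zero hw := by simp [price_proposedRanking le_rfl hw]
  le_price hq hw := by
    rw [price_proposedRanking hq hw]
    have := div_nonneg hq hw.le
    linarith

lemma hasReservePrice_standardRanking {r : ℝ} (hr : 0 < r) :
    HasReservePrice (standardRanking r) r where
  nonneg {b w} hw := by
    unfold standardRanking
    split_ifs with h
    · exact mul_nonneg (hr.le.trans h) hw.le
    · exact le_rfl
  price_zero hw := by simp [price_standardRanking le_rfl hw, hr.le]
  le_price hq hw := by
    rw [price_standardRanking hq hw]
    exact le_max_left _ _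

/-! ### Symmetric Nash equilibria with a reserve price -/

namespace Outcome

variable {n m : ℕ} {s : Fin m → ℝ} {y : ℝ → ℝ → ℝ} {r : ℝ} {p : Types n} {o : Outcome n}

lemma nextScore_nonneg (hy : HasReservePrice y r) {w : Fin n → ℝ} (hw : ∀ i, 0 < w i) (k : ℕ) :
    0 ≤ o.nextScore y w k := by
  unfold nextScore
  split_ifs
  · exact hy.nonneg (hw _)
  · exact le_rfl

lemma nextScore_eq_zero (hy : HasReservePrice y r) {w : Fin n → ℝ} (hw : ∀ i, 0 < w i)
    (ho : o.IsSorted y w) {i : Fin n} (hi : y (o.bid i) (w i) = 0) :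
    o.nextScore y w (o.rank i) = 0 := by
  unfold nextScore
  split_ifs with h
  · refine le_antisymm ?_ (hy.nonneg (hw _))
    rw [← hi]
    apply ho
    rw [Equiv.apply_symm_apply, Fin.lt_def]
    simp
  · rfl

lemma le_priceAt (hy : HasReservePrice y r) {w : Fin n → ℝ} (hw : ∀ i, 0 < w i) (k : ℕ)
    (i : Fin n) : r ≤ o.priceAt y w k (w i) :=
  hy.le_price (nextScore_nonneg hy hw k) (hw i)

lemma alloc_nonneg (hs_pos : ∀ k, 0 < s k) {w : Fin n → ℝ} (i : Fin n) :
    0 ≤ o.alloc y s w i := by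
  unfold alloc
  split_ifs
  · exact slotEffect_nonneg hs_pos _
  · exact le_rfl

lemma alloc_le (hs : StrictAnti s) (hs_pos : ∀ k, 0 < s k) {w : Fin n → ℝ} (i : Fin n) :
    o.alloc y s w i ≤ slotEffect s 0 := by
  unfold alloc
  split_ifs
  · exact slotEffect_antitone hs hs_pos (Nat.zero_le _)
  · exact slotEffect_nonneg hs_pos _

/-- Not being displayed is an option, so the utility is nonnegative. -/
lemma IsSNE.utility_nonneg (ho : o.IsSNE y s p) (i : Fin n) :
    0 ≤ (p.1 i - o.priceAt y p.2 (o.rank i) (p.2 i)) * o.alloc y s p.2 i := by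
  simpa [slotEffect_of_le (le_refl m)] using ho.2 i m

lemma IsSNE.alloc_eq_zero (hy : HasReservePrice y r) (hs_pos : ∀ k, 0 < s k)
    (hw : ∀ i, 0 < p.2 i) (ho : o.IsSNE y s p) {i : Fin n} (hi : p.1 i < r) :
    o.alloc y s p.2 i = 0 := by
  by_contra h
  have hpos := lt_of_le_of_ne (alloc_nonneg hs_pos i) (Ne.symm h)
  have h1 := ho.utility_nonneg i
  have h2 := le_priceAt (o := o) hy hw (o.rank i) i
  nlinarith

/-- An excluded advertiser is followed by scores 0 only, so its own position is on offer at price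
`r`; declining it is optimal only if the effect there is 0. -/
lemma IsSNE.alloc_eq_slotEffect (hy : HasReservePrice y r) (hs_pos : ∀ k, 0 < s k)
    (hw : ∀ i, 0 < p.2 i) (ho : o.IsSNE y s p) {i : Fin n} (hi : r < p.1 i) :
    o.alloc y s p.2 i = slotEffect s (o.rank i) := by
  by_cases h : 0 < y (o.bid i) (p.2 i)
  · simp [alloc, h]
  · have h0 : y (o.bid i) (p.2 i) = 0 := le_antisymm (not_lt.mp h) (hy.nonneg (hw i))
    have h1 := ho.2 i (o.rank i)
    have hx : o.alloc y s p.2 i = 0 := by simp [alloc, h]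
    rw [hx, priceAt, nextScore_eq_zero hy hw ho.1 h0, hy.price_zero (hw i)] at h1
    have := slotEffect_nonneg hs_pos (o.rank i)
    rw [hx]
    nlinarith

/-- An advertiser with a value above the reserve price is never ranked below one with a value below
it who has an effective slot. -/
lemma IsSNE.slotEffect_eq_zero (hy : HasReservePrice y r) (hs : StrictAnti s)
    (hs_pos : ∀ k, 0 < s k) (hw : ∀ i, 0 < p.2 i) (ho : o.IsSNE y s p) {i j : Fin n}
    (hi : r < p.1 i) (hj : p.1 j < r) (hij : o.rank j < o.rank i) :
    slotEffect s (o.rank j) = 0 := by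
  by_contra h
  have hpos := lt_of_le_of_ne (slotEffect_nonneg hs_pos _) (Ne.symm h)
  have hlt := slotEffect_lt hs (Fin.lt_def.mp hij) hpos
  have hxj := ho.alloc_eq_zero hy hs_pos hw hj
  have h0 : y (o.bid j) (p.2 j) = 0 := by
    refine le_antisymm (not_lt.mp fun hyj => h ?_) (hy.nonneg (hw j))
    simpa [alloc, hyj] using hxj
  -- The slot of `j` is vacant and priced at `r`, and it beats that of `i`, who pays at least `r`.
  have h1 := ho.2 i (o.rank j)
  have h2 := le_priceAt (o := o) hy hw (o.rank i) i
  rw [ho.alloc_eq_slotEffect hy hs_pos hw hi, priceAt, nextScore_eq_zero hy hw ho.1 h0,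
    hy.price_zero (hw i)] at h1
  have h3 := slotEffect_nonneg hs_pos (o.rank i)
  nlinarith

lemma payment_nonneg (hy : HasReservePrice y r) (hr : 0 < r) (hs_pos : ∀ k, 0 < s k)
    {w : Fin n → ℝ} (hw : ∀ i, 0 < w i) (i : Fin n) :
    0 ≤ o.priceAt y w (o.rank i) (w i) * w i * o.alloc y s w i :=
  mul_nonneg (mul_nonneg (hr.le.trans (le_priceAt hy hw _ i)) (hw i).le) (alloc_nonneg hs_pos i)

/-! ### Order of the advertisers in equilibrium -/

/-- The equilibrium condition for the proposed ranking in terms of the values per impression. -/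
lemma IsSNE.proposed (hw : ∀ i, 0 < p.2 i)
    (ho : o.IsSNE (proposedRanking r) s p) (i : Fin n) (k : ℕ) :
    ((p.1 i - r) * p.2 i - o.nextScore (proposedRanking r) p.2 k) * slotEffect s k ≤
      ((p.1 i - r) * p.2 i - o.nextScore (proposedRanking r) p.2 (o.rank i)) *
        o.alloc (proposedRanking r) s p.2 i := by
  have h := ho.2 i k
  have hy := hasReservePrice_proposedRanking r
  rw [priceAt, priceAt, price_proposedRanking (nextScore_nonneg hy hw _) (hw i),
    price_proposedRanking (nextScore_nonneg hy hw _) (hw i)] at h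
  have hwi := (hw i).ne'
  have key : ∀ q x : ℝ, ((p.1 i - r) * p.2 i - q) * x = (p.1 i - (r + q / p.2 i)) * x * p.2 i := by
    intro q x
    field_simp
    ring
  rw [key, key]
  exact mul_le_mul_of_nonneg_right h (hw i).le

/-- For two values above `r`, adding the two mutual no-envy conditions cancels the prices and leaves
(v_j - v_i)(S_i - S_j) ≤ 0. -/
lemma IsSNE.proposed_order (hs : StrictAnti s) (hs_pos : ∀ k, 0 < s k) (hw : ∀ i, 0 < p.2 i)
    (hne : ∀ i, p.1 i ≠ r) (ho : o.IsSNE (proposedRanking r) s p) {i j : Fin n}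
    (hij : o.rank i < o.rank j) (hpos : 0 < slotEffect s (o.rank i)) :
    proposedRanking r (p.1 j) (p.2 j) ≤ proposedRanking r (p.1 i) (p.2 i) := by
  have hy := hasReservePrice_proposedRanking r
  rcases lt_or_gt_of_ne (hne j) with hj | hj
  · have : proposedRanking r (p.1 j) (p.2 j) = 0 := by
      simp [proposedRanking, max_eq_right (sub_nonpos.mpr hj.le)]
    rw [this]
    exact hy.nonneg (hw i)
  have hi : r < p.1 i := by
    rcases lt_or_gt_of_ne (hne i) with hi | hi
    · exact absurd (ho.slotEffect_eq_zero hy hs hs_pos hw hj hi hij) hpos.ne'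
    · exact hi
  have h1 := ho.proposed hw i (o.rank j)
  have h2 := ho.proposed hw j (o.rank i)
  rw [ho.alloc_eq_slotEffect hy hs_pos hw hi] at h1
  rw [ho.alloc_eq_slotEffect hy hs_pos hw hj] at h2
  have hlt := slotEffect_lt hs (Fin.lt_def.mp hij) hpos
  rw [proposedRanking, proposedRanking, max_eq_left (sub_nonneg.mpr hi.le),
    max_eq_left (sub_nonneg.mpr hj.le)]
  by_contra hlt'
  push Not at hlt'
  nlinarith [mul_pos (sub_pos.mpr hlt') (sub_pos.mpr hlt)]

/-- The equilibrium condition for the standard ranking in terms of the values per impression. -/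
lemma IsSNE.standard (hr : 0 < r) (hw : ∀ i, 0 < p.2 i)
    (ho : o.IsSNE (standardRanking r) s p) (i : Fin n) (k : ℕ) :
    (p.1 i * p.2 i - max (r * p.2 i) (o.nextScore (standardRanking r) p.2 k)) * slotEffect s k ≤
      (p.1 i * p.2 i - max (r * p.2 i) (o.nextScore (standardRanking r) p.2 (o.rank i))) *
        o.alloc (standardRanking r) s p.2 i := by
  have h := ho.2 i k
  have hy := hasReservePrice_standardRanking hr
  rw [priceAt, priceAt, price_standardRanking (nextScore_nonneg hy hw _) (hw i),
    price_standardRanking (nextScore_nonneg hy hw _) (hw i)] at h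
  have key : ∀ q, max (r * p.2 i) q = max r (q / p.2 i) * p.2 i := fun q => by
    rw [max_mul_of_nonneg _ _ (hw i).le, div_mul_cancel₀ _ (hw i).ne']
  rw [key, key]
  have h' := mul_le_mul_of_nonneg_right h (hw i).le
  linarith

/-- In equilibrium under the standard ranking, an advertiser ranked above a more relevant one has
the higher value per impression. -/
lemma IsSNE.standard_order (hr : 0 < r) (hs : StrictAnti s) (hs_pos : ∀ k, 0 < s k)
    (hw : ∀ i, 0 < p.2 i) (ho : o.IsSNE (standardRanking r) s p) {i j : Fin n}
    (hi : r < p.1 i) (hj : r < p.1 j) (hij : o.rank i < o.rank j)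
    (hpos : 0 < slotEffect s (o.rank i)) (hwij : p.2 i ≤ p.2 j) :
    p.1 j * p.2 j ≤ p.1 i * p.2 i := by
  have hy := hasReservePrice_standardRanking hr
  have h1 := ho.standard hr hw i (o.rank j)
  have h2 := ho.standard hr hw j (o.rank i)
  rw [ho.alloc_eq_slotEffect hy hs_pos hw hi] at h1
  rw [ho.alloc_eq_slotEffect hy hs_pos hw hj] at h2
  have hlt := slotEffect_lt hs (Fin.lt_def.mp hij) hpos
  have h0 := slotEffect_nonneg hs_pos (o.rank j)
  set a := slotEffect s (o.rank i)
  set b := slotEffect s (o.rank j)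
  set q := o.nextScore (standardRanking r) p.2 (o.rank i)
  set q' := o.nextScore (standardRanking r) p.2 (o.rank j)
  have hrw : r * p.2 i ≤ r * p.2 j := mul_le_mul_of_nonneg_left hwij hr.le
  -- If the reserve were binding for `j` in the position of `i`, then `j` would gain by moving up.
  -- Hence both would pay the same `q` per impression there.
  have hq : r * p.2 j < q := by
    by_contra hq
    rw [max_eq_left (not_lt.mp hq)] at h2
    have := le_max_left (r * p.2 j) q'
    nlinarith [mul_pos (sub_pos.mpr hlt) (mul_pos (sub_pos.mpr hj) (hw j))]
  rw [max_eq_right hq.le] at h2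
  rw [max_eq_right (hrw.trans hq.le)] at h1
  -- In the lower position the payments may differ through the reserve; `hwij` gives the difference
  -- the sign needed when the two conditions are added.
  have hq' : max (r * p.2 i) q' ≤ max (r * p.2 j) q' := max_le_max hrw le_rfl
  by_contra hlt'
  push Not at hlt'
  nlinarith [mul_pos (sub_pos.mpr hlt') (sub_pos.mpr hlt), mul_nonneg h0 (sub_nonneg.mpr hq')]

end Outcome

/-! ### Comparison of two rankings -/

/-- The differences `T \ U` and `U \ T` are equinumerous, and the maximum of `a` on `U \ T`
separates the two sums. -/
lemma sum_le_sum_of_card_eq {ι : Type*} [DecidableEq ι] {T U : Finset ι} (hcard : T.card = U.card)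
    {a : ι → ℝ} (h : ∀ i ∈ T \ U, ∀ j ∈ U \ T, a j ≤ a i) : ∑ i ∈ U, a i ≤ ∑ i ∈ T, a i := by
  have hcard' : (T \ U).card = (U \ T).card := Finset.card_sdiff_comm hcard
  have hT := Finset.sum_inter_add_sum_sdiff T U a
  have hU := Finset.sum_inter_add_sum_sdiff U T a
  rw [Finset.inter_comm] at hU
  suffices ∑ i ∈ U \ T, a i ≤ ∑ i ∈ T \ U, a i by linarith
  rcases (U \ T).eq_empty_or_nonempty with he | hne
  · rw [he, Finset.card_empty, Finset.card_eq_zero] at hcard'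
    rw [he, hcard']
  · obtain ⟨j, hj, hmax⟩ := Finset.exists_max_image (U \ T) a hne
    calc ∑ i ∈ U \ T, a i ≤ (U \ T).card • a j := Finset.sum_le_card_nsmul _ _ _ hmax
      _ = (T \ U).card • a j := by rw [hcard']
      _ ≤ ∑ i ∈ T \ U, a i := Finset.card_nsmul_le_sum _ _ _ fun i hi => h i hi j hj

/-- The first `k + 1` advertisers of a ranking. -/
def topSet {n : ℕ} (ρ : Equiv.Perm (Fin n)) (k : ℕ) : Finset (Fin n) :=
  Finset.univ.filter fun i => (ρ i : ℕ) ≤ k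

lemma mem_topSet {n : ℕ} {ρ : Equiv.Perm (Fin n)} {k : ℕ} {i : Fin n} :
    i ∈ topSet ρ k ↔ (ρ i : ℕ) ≤ k := by simp [topSet]

lemma card_topSet_eq {n : ℕ} (ρ σ : Equiv.Perm (Fin n)) (k : ℕ) :
    (topSet ρ k).card = (topSet σ k).card := by
  have h : ∀ τ : Equiv.Perm (Fin n),
      (topSet τ k).card = (Finset.univ.filter fun i : Fin n => (i : ℕ) ≤ k).card := fun τ =>
    Finset.card_equiv τ fun i => by simp [topSet]
  rw [h, h]

lemma card_topSet {n : ℕ} (ρ : Equiv.Perm (Fin n)) {k : ℕ} (hk : k < n) :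
    (topSet ρ k).card = k + 1 := by
  rw [card_topSet_eq ρ 1 k]
  have : topSet (1 : Equiv.Perm (Fin n)) k = Finset.Iic (⟨k, hk⟩ : Fin n) := by
    ext i; simp [mem_topSet, Fin.le_def]
  rw [this, Fin.card_Iic]

/-- Summation by parts: a weighted sum of slot effects in terms of the top sets. -/
lemma sum_mul_rank_eq {n : ℕ} (ρ : Equiv.Perm (Fin n)) (S : ℕ → ℝ) (a : Fin n → ℝ) :
    ∑ i, a i * S (ρ i) =
      S n * ∑ i, a i + ∑ k ∈ Finset.range n, (S k - S (k + 1)) * ∑ i ∈ topSet ρ k, a i := by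
  -- Telescoping stops at `S n`, which need not vanish when there are more slots than advertisers.
  have hS : ∀ l : ℕ, l ≤ n → S l = S n + ∑ k ∈ Finset.range n,
      if l ≤ k then S k - S (k + 1) else 0 := by
    intro l hl
    rw [← Finset.sum_filter]
    have : (Finset.range n).filter (fun k => l ≤ k) = Finset.Ico l n := by
      ext k; simp [and_comm]
    have h2 := Finset.sum_Ico_sub (f := S) hl
    have h3 : ∑ k ∈ Finset.Ico l n, (S k - S (k + 1)) = -∑ k ∈ Finset.Ico l n, (S (k + 1) - S k) := by
      rw [← Finset.sum_neg_distrib]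
      exact Finset.sum_congr rfl fun k _ => by ring
    rw [this, h3, h2]
    ring
  calc ∑ i, a i * S (ρ i) = ∑ i, (S n * a i + ∑ k ∈ Finset.range n,
        if (ρ i : ℕ) ≤ k then (S k - S (k + 1)) * a i else 0) := by
        refine Finset.sum_congr rfl fun i _ => ?_
        rw [hS (ρ i) (ρ i).is_lt.le, mul_add, Finset.mul_sum, mul_comm]
        congr 1
        refine Finset.sum_congr rfl fun k _ => ?_
        split_ifs <;> ring
    _ = _ := by
        rw [Finset.sum_add_distrib, ← Finset.mul_sum, Finset.sum_comm]
        congr 1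
        refine Finset.sum_congr rfl fun k _ => ?_
        rw [topSet, Finset.sum_filter, Finset.mul_sum]
        refine Finset.sum_congr rfl fun i _ => ?_
        split_ifs <;> simp

section Compare

variable {n : ℕ} {ρ σ : Equiv.Perm (Fin n)} {S : ℕ → ℝ} {a : Fin n → ℝ}

lemma topSet_sum_le
    (h : ∀ k i j, S (k + 1) < S k → (ρ i : ℕ) ≤ k → k < ρ j → (σ j : ℕ) ≤ k → k < σ i → a j ≤ a i)
    {k : ℕ} (hk : S (k + 1) < S k) : ∑ i ∈ topSet σ k, a i ≤ ∑ i ∈ topSet ρ k, a i := by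
  refine sum_le_sum_of_card_eq (card_topSet_eq ρ σ k) fun i hi j hj => ?_
  simp only [Finset.mem_sdiff, mem_topSet, not_le] at hi hj
  exact h k i j hk hi.1 hj.2 hj.1 hi.2

/-- If all pairs that the rankings `ρ` and `σ` order differently across a drop of the effects are
ordered by `ρ` according to the weights, then `ρ` has the larger weighted sum of effects. -/
lemma sum_mul_rank_le (hS : Antitone S)
    (h : ∀ k i j, S (k + 1) < S k → (ρ i : ℕ) ≤ k → k < ρ j → (σ j : ℕ) ≤ k → k < σ i →
      a j ≤ a i) :
    ∑ i, a i * S (σ i) ≤ ∑ i, a i * S (ρ i) := by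
  rw [sum_mul_rank_eq, sum_mul_rank_eq]
  refine add_le_add le_rfl (Finset.sum_le_sum fun k _ => ?_)
  rcases (hS (Nat.le_succ k)).eq_or_lt with h0 | h0
  · rw [Nat.succ_eq_add_one] at h0
    simp [h0]
  · exact mul_le_mul_of_nonneg_left (topSet_sum_le h h0) (sub_nonneg.mpr h0.le)

/-- Strictness comes from the term `k = 0`, where each top set is a single advertiser. -/
lemma sum_mul_rank_lt (hS : Antitone S)
    (h : ∀ k i j, S (k + 1) < S k → (ρ i : ℕ) ≤ k → k < ρ j → (σ j : ℕ) ≤ k → k < σ i →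
      a j ≤ a i)
    (h01 : S 1 < S 0) {i j : Fin n} (hi : (ρ i : ℕ) = 0) (hj : (σ j : ℕ) = 0) (hij : a j < a i) :
    ∑ i, a i * S (σ i) < ∑ i, a i * S (ρ i) := by
  rw [sum_mul_rank_eq, sum_mul_rank_eq]
  refine add_lt_add_of_le_of_lt le_rfl ?_
  have top : ∀ (τ : Equiv.Perm (Fin n)) (l : Fin n), (τ l : ℕ) = 0 → topSet τ 0 = {l} := by
    intro τ l hl
    ext l'
    rw [mem_topSet, Finset.mem_singleton, ← τ.injective.eq_iff, Fin.ext_iff, hl]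
    omega
  refine Finset.sum_lt_sum (fun k _ => ?_)
    ⟨0, Finset.mem_range.mpr ((Nat.zero_le _).trans_lt i.is_lt), ?_⟩
  · rcases (hS (Nat.le_succ k)).eq_or_lt with h0 | h0
    · rw [Nat.succ_eq_add_one] at h0
      simp [h0]
    · exact mul_le_mul_of_nonneg_left (topSet_sum_le h h0) (sub_nonneg.mpr h0.le)
  · rw [top ρ i hi, top σ j hj, Finset.sum_singleton, Finset.sum_singleton]
    exact mul_lt_mul_of_pos_left hij (sub_pos.mpr h01)

end Compare

/-! ### The law of a single value -/

/-- The inverse hazard rate `(1 - F(t)) / f(t)`. -/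
def inverseHazard (f : ℝ → ℝ) (t : ℝ) : ℝ := (1 - valueCDF f t) / f t

lemma virtualValue_eq (f : ℝ → ℝ) (t : ℝ) : virtualValue f t = t - inverseHazard f t := rfl

lemma valueCDF_mono (f : ℝ → ℝ) : Monotone (valueCDF f) := (ProbabilityTheory.cdf (valueLaw f)).mono

lemma valueCDF_le_one (f : ℝ → ℝ) (t : ℝ) : valueCDF f t ≤ 1 := ProbabilityTheory.cdf_le_one _ _

lemma valueLaw_singleton (f : ℝ → ℝ) (t : ℝ) : valueLaw f {t} = 0 :=
  withDensity_absolutelyContinuous _ _ (measure_singleton t)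

lemma ae_valueLaw_ne (f : ℝ → ℝ) (t : ℝ) : ∀ᵐ x ∂valueLaw f, x ≠ t := by
  rw [ae_iff]
  simpa using valueLaw_singleton f t

namespace IsRegularDensity

variable {f : ℝ → ℝ}

lemma valueLaw_Iic (hf : IsRegularDensity f) (t : ℝ) :
    valueLaw f (Set.Iic t) = ENNReal.ofReal (valueCDF f t) := by
  have := hf.isProbabilityMeasure
  rw [valueCDF, ProbabilityTheory.cdf_eq_real, ofReal_measureReal]

lemma valueLaw_Ioi (hf : IsRegularDensity f) (t : ℝ) :
    valueLaw f (Set.Ioi t) = ENNReal.ofReal (1 - valueCDF f t) := by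
  have := hf.isProbabilityMeasure
  rw [← Set.compl_Iic, prob_compl_eq_one_sub measurableSet_Iic, hf.valueLaw_Iic,
    ENNReal.ofReal_sub _ (show 0 ≤ valueCDF f t from ProbabilityTheory.cdf_nonneg _ _),
    ENNReal.ofReal_one]

lemma ae_pos (hf : IsRegularDensity f) : ∀ᵐ t ∂valueLaw f, 0 < t := by
  rw [ae_iff]
  have : {t : ℝ | ¬ 0 < t} = Set.Iic 0 := by ext; simp
  rw [this, hf.valueLaw_Iic, hf.cdf_zero, ENNReal.ofReal_zero]

/-- The exceptional set is a closed half-line, if not empty. Near each of its points it lies in some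
`Set.Ici u` with F(u) = 1, which is null because there are no atoms. -/
lemma ae_valueCDF_lt_one (hf : IsRegularDensity f) : ∀ᵐ t ∂valueLaw f, valueCDF f t < 1 := by
  rw [ae_iff]
  refine measure_null_of_locally_null _ fun t ht => ?_
  have ht1 : valueCDF f t = 1 := le_antisymm (valueCDF_le_one f t) (not_lt.mp ht)
  have hIci : ∀ u, valueCDF f u = 1 → valueLaw f (Set.Ici u) = 0 := by
    intro u hu
    rw [← Set.Ioi_union_left]
    exact measure_union_null (by rw [hf.valueLaw_Ioi, hu, sub_self, ENNReal.ofReal_zero])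
      (valueLaw_singleton f u)
  by_cases hmin : ∃ u < t, valueCDF f u = 1
  · obtain ⟨u, hut, hu⟩ := hmin
    exact ⟨Set.Ici u, mem_nhdsWithin_of_mem_nhds (Ici_mem_nhds hut), hIci u hu⟩
  · refine ⟨Set.Ici t, Filter.mem_of_superset self_mem_nhdsWithin fun u hu => ?_, hIci t ht1⟩
    by_contra hut
    exact hmin ⟨u, not_le.mp hut, le_antisymm (valueCDF_le_one f u) (not_lt.mp hu)⟩

/-- A zero of `f` at `t` would force the monotone hazard rate to vanish on (0, t], giving F(t) = 0
against the support at zero. -/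
lemma pos (hf : IsRegularDensity f) {t : ℝ} (ht : t ∈ valueRange f) : 0 < f t := by
  refine lt_of_le_of_ne (hf.nonneg t) fun h => ?_
  have hzero : ∀ u ∈ Set.Ioc 0 t, f u = 0 := by
    intro u hu
    have hu1 : valueCDF f u < 1 := (valueCDF_mono f hu.2).trans_lt ht.2
    have := hf.hazard_monotone ⟨hu.1, hu1⟩ ht hu.2
    simp only [← h, zero_div] at this
    have h1 : 0 < 1 - valueCDF f u := sub_pos.mpr hu1
    rw [div_le_iff₀ h1, zero_mul] at this
    exact le_antisymm this (hf.nonneg u)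
  have h1 : valueLaw f (Set.Ioc 0 t) = 0 := by
    rw [valueLaw, withDensity_apply _ measurableSet_Ioc]
    rw [setLIntegral_congr_fun measurableSet_Ioc
      (g := fun _ => 0) fun u hu => by simp [hzero u hu]]
    simp
  have h2 : valueLaw f (Set.Iic t) = 0 := by
    rw [← Set.Iic_union_Ioc_eq_Iic ht.1.le]
    exact measure_union_null (by rw [hf.valueLaw_Iic, hf.cdf_zero, ENNReal.ofReal_zero]) h1
  rw [hf.valueLaw_Iic, ENNReal.ofReal_eq_zero] at h2
  exact absurd (hf.support_at_zero t ht.1) (not_lt.mpr h2)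

lemma inverseHazard_nonneg (hf : IsRegularDensity f) (t : ℝ) : 0 ≤ inverseHazard f t :=
  div_nonneg (sub_nonneg.mpr (valueCDF_le_one f t)) (hf.nonneg t)

lemma inverseHazard_le (hf : IsRegularDensity f) {t u : ℝ} (ht : 0 < t) (htu : t ≤ u) :
    inverseHazard f u ≤ inverseHazard f t := by
  rcases (valueCDF_le_one f u).eq_or_lt with hu | hu
  · rw [inverseHazard, hu, sub_self, zero_div]
    exact hf.inverseHazard_nonneg t
  · have ht' : t ∈ valueRange f := ⟨ht, (valueCDF_mono f htu).trans_lt hu⟩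
    have hu' : u ∈ valueRange f := ⟨ht.trans_le htu, hu⟩
    have h := hf.hazard_monotone ht' hu' htu
    have h1 : 0 < f t / (1 - valueCDF f t) := div_pos (hf.pos ht') (sub_pos.mpr ht'.2)
    have h2 := inv_anti₀ h1 h
    rwa [inv_div, inv_div] at h2

lemma virtualValue_strictMono (hf : IsRegularDensity f) {t u : ℝ} (ht : 0 < t) (htu : t < u) :
    virtualValue f t < virtualValue f u := by
  have := hf.inverseHazard_le ht htu.le
  rw [virtualValue_eq, virtualValue_eq]
  linarith

lemma valueRange_mem_nhds {t : ℝ} (ht : t ∈ valueRange f) : valueRange f ∈ nhds t := by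
  have hcont : ContinuousWithinAt (valueCDF f) (Set.Ici t) t :=
    (ProbabilityTheory.cdf (valueLaw f)).right_continuous t
  have h1 : ∀ᶠ u in nhdsWithin t (Set.Ici t), valueCDF f u < 1 :=
    hcont.eventually (gt_mem_nhds ht.2)
  have h2 : ∀ᶠ u in nhdsWithin t (Set.Ioi t), valueCDF f u < 1 ∧ u ∈ Set.Ioi t :=
    (h1.filter_mono (nhdsWithin_mono _ Set.Ioi_subset_Ici_self)).and self_mem_nhdsWithin
  obtain ⟨v, hv, htv⟩ := h2.exists
  refine Filter.mem_of_superset (Ioo_mem_nhds ht.1 htv) fun u hu => ⟨hu.1, ?_⟩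
  exact (valueCDF_mono f hu.2.le).trans_lt hv

lemma differentiableAt (hf : IsRegularDensity f) {t : ℝ} (ht : t ∈ valueRange f) :
    DifferentiableAt ℝ (virtualValue f) t :=
  (hf.differentiable t ht).differentiableAt (valueRange_mem_nhds ht)

/-- The difference φ(t) - t is minus the inverse hazard rate, hence non-decreasing. -/
lemma one_le_deriv (hf : IsRegularDensity f) {t : ℝ} (ht : t ∈ valueRange f) :
    1 ≤ deriv (virtualValue f) t := by
  have hmono : MonotoneOn (fun u => virtualValue f u - u) (valueRange f) := by
    intro u hu v _ huv
    have := hf.inverseHazard_le hu.1 huv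
    simp only [virtualValue_eq]
    linarith
  have h := hmono.derivWithin_nonneg (x := t)
  rw [derivWithin_of_mem_nhds (valueRange_mem_nhds ht),
    deriv_fun_sub (hf.differentiableAt ht) differentiableAt_fun_id, deriv_id''] at h
  linarith

/-- The virtual value grows at least as fast as the distance from `r`. -/
lemma virtualValue_mul_le (hf : IsRegularDensity f) {r : ℝ} (hr_pos : 0 < r)
    (hr : ∀ t, r ≤ t → valueCDF f t < 1 →
      r ≤ t - virtualValue f t / deriv (virtualValue f) t)
    {a b : ℝ} (ha : r < a) (hab : a ≤ b) (hb : valueCDF f b < 1) :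
    virtualValue f a * (b - r) ≤ virtualValue f b * (a - r) := by
  have hmem : ∀ t ∈ Set.Icc a b, t ∈ valueRange f := fun t ht =>
    ⟨hr_pos.trans (ha.trans_le ht.1), (valueCDF_mono f ht.2).trans_lt hb⟩
  have hne : ∀ t ∈ Set.Icc a b, t - r ≠ 0 := fun t ht => (sub_pos.mpr (ha.trans_le ht.1)).ne'
  have hdiff : ∀ t ∈ Set.Icc a b,
      HasDerivAt (fun t => virtualValue f t / (t - r))
        ((deriv (virtualValue f) t * (t - r) - virtualValue f t * 1) / (t - r) ^ 2) t := fun t ht =>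
    (hf.differentiableAt (hmem t ht)).hasDerivAt.div ((hasDerivAt_id t).sub_const r) (hne t ht)
  -- The numerator of the derivative is φ'(t)(t - r) - φ(t); its nonnegativity is the condition on
  -- `r` multiplied by φ'(t) > 0.
  have hmono : MonotoneOn (fun t => virtualValue f t / (t - r)) (Set.Icc a b) := by
    refine monotoneOn_of_deriv_nonneg (convex_Icc a b)
      (fun t ht => (hdiff t ht).continuousAt.continuousWithinAt)
      (fun t ht => (hdiff t (interior_subset ht)).differentiableAt.differentiableWithinAt)
      fun t ht => ?_
    have ht' := interior_subset ht
    rw [(hdiff t ht').deriv]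
    refine div_nonneg ?_ (sq_nonneg _)
    have h1 := hr t (ha.le.trans ht'.1) (hmem t ht').2
    have h2 : 0 < deriv (virtualValue f) t := zero_lt_one.trans_le (hf.one_le_deriv (hmem t ht'))
    have h3 : virtualValue f t / deriv (virtualValue f) t ≤ t - r := by linarith
    rw [div_le_iff₀ h2] at h3
    linarith
  have h := hmono (Set.left_mem_Icc.mpr hab) (Set.right_mem_Icc.mpr hab) hab
  have h1 : 0 < a - r := sub_pos.mpr ha
  have h2 : 0 < b - r := sub_pos.mpr (ha.trans_le hab)
  rwa [div_le_div_iff₀ h1 h2] at h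

/-- If the less relevant of two advertisers has the higher value per impression net of `r`, then it
has the higher virtual value per impression. -/
lemma virtualValue_mul_lt_mul (hf : IsRegularDensity f) {r : ℝ} (hr_pos : 0 < r)
    (hr : ∀ t, r ≤ t → valueCDF f t < 1 →
      r ≤ t - virtualValue f t / deriv (virtualValue f) t)
    {a b v w : ℝ} (ha : r < a) (hb1 : valueCDF f b < 1)
    (hw : 0 < w) (hwv : w ≤ v) (h : (a - r) * v < (b - r) * w) :
    virtualValue f a * v < virtualValue f b * w := by
  have hab : a < b := by
    by_contra hba
    push Not at hba
    nlinarith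
  have hφ := hf.virtualValue_strictMono (hr_pos.trans ha) hab
  have hc := hf.virtualValue_mul_le hr_pos hr ha hab.le hb1
  -- If φ(a) > 0, then φ(a)v(a - r) < φ(a)(b - r)w ≤ φ(b)(a - r)w, and a - r cancels. If φ(a) ≤ 0,
  -- the larger relevance `v` only lowers the left side, and φ(a) < φ(b) suffices.
  rcases lt_or_ge 0 (virtualValue f a) with h0 | h0
  · have h1 : 0 < a - r := sub_pos.mpr ha
    by_contra hcon
    push Not at hcon
    nlinarith [mul_le_mul_of_nonneg_right hcon h1.le, mul_le_mul_of_nonneg_right hc hw.le,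
      mul_lt_mul_of_pos_left h h0]
  · rcases lt_or_ge 0 (virtualValue f b) with h2 | h2
    · nlinarith [mul_pos h2 hw]
    · nlinarith

lemma virtualValue_mul_le_mul (hf : IsRegularDensity f) {r : ℝ} (hr_pos : 0 < r)
    (hr : ∀ t, r ≤ t → valueCDF f t < 1 →
      r ≤ t - virtualValue f t / deriv (virtualValue f) t)
    {a b v w : ℝ} (ha : r < a) (hb1 : valueCDF f b < 1)
    (hw : 0 < w) (hwv : w ≤ v) (h : (a - r) * v ≤ (b - r) * w) :
    virtualValue f a * v ≤ virtualValue f b * w := by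
  have hab : a ≤ b := by
    by_contra hba
    push Not at hba
    nlinarith
  have hφ : virtualValue f a ≤ virtualValue f b := by
    rcases hab.eq_or_lt with rfl | hab
    · exact le_rfl
    · exact (hf.virtualValue_strictMono (hr_pos.trans ha) hab).le
  have hc := hf.virtualValue_mul_le hr_pos hr ha hab hb1
  rcases lt_or_ge 0 (virtualValue f a) with h0 | h0
  · have h1 : 0 < a - r := sub_pos.mpr ha
    by_contra hcon
    push Not at hcon
    nlinarith [mul_lt_mul_of_pos_right hcon h1, mul_le_mul_of_nonneg_right hc hw.le,
      mul_le_mul_of_nonneg_left h h0.le]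
  · rcases lt_or_ge 0 (virtualValue f b) with h2 | h2
    · nlinarith [mul_pos h2 hw]
    · nlinarith

lemma valueLaw_Ioo_pos (hf : IsRegularDensity f) {a b : ℝ} (ha : 0 ≤ a) (hab : a < b)
    (hb : valueCDF f b < 1) : 0 < valueLaw f (Set.Ioo a b) := by
  rw [pos_iff_ne_zero, valueLaw, withDensity_apply _ measurableSet_Ioo]
  rw [← pos_iff_ne_zero, setLIntegral_pos_iff hf.measurable.ennreal_ofReal]
  have : Function.support (fun t => ENNReal.ofReal (f t)) ∩ Set.Ioo a b = Set.Ioo a b := by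
    refine Set.inter_eq_right.mpr fun t ht => ?_
    have := hf.pos (t := t) ⟨ha.trans_lt ht.1, (valueCDF_mono f ht.2.le).trans_lt hb⟩
    simpa using this
  rw [this]
  simpa using hab

/-- Integration by parts, in terms of the inverse hazard rate. -/
lemma lintegral_lintegral_Ioo (hf : IsRegularDensity f) {r : ℝ} (hr : 0 < r)
    {H : ℝ → ENNReal} (hH : Measurable H) :
    ∫⁻ t, (∫⁻ z in Set.Ioo r t, H z) ∂valueLaw f =
      ∫⁻ t in Set.Ioi r, H t * ENNReal.ofReal (inverseHazard f t) ∂valueLaw f := by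
  have := hf.isProbabilityMeasure
  have hF : Measurable (valueCDF f) := (valueCDF_mono f).measurable
  have hmeas : Measurable fun x : ℝ × ℝ =>
      {x : ℝ × ℝ | r < x.2 ∧ x.2 < x.1}.indicator (fun x => H x.2) x :=
    (hH.comp measurable_snd).indicator ((measurableSet_lt measurable_const measurable_snd).inter
      (measurableSet_lt measurable_snd measurable_fst))
  calc ∫⁻ t, (∫⁻ z in Set.Ioo r t, H z) ∂valueLaw f
      = ∫⁻ t, (∫⁻ z, {x : ℝ × ℝ | r < x.2 ∧ x.2 < x.1}.indicator (fun x => H x.2) (t, z))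
          ∂valueLaw f := by
        refine lintegral_congr fun t => ?_
        rw [← lintegral_indicator measurableSet_Ioo]
        rfl
    _ = ∫⁻ z, ∫⁻ t, {x : ℝ × ℝ | r < x.2 ∧ x.2 < x.1}.indicator (fun x => H x.2) (t, z)
          ∂valueLaw f := lintegral_lintegral_swap hmeas.aemeasurable
    _ = ∫⁻ z, (Set.Ioi r).indicator
          (fun z => H z * ENNReal.ofReal (1 - valueCDF f z)) z := by
        refine lintegral_congr fun z => ?_
        by_cases hz : r < z
        · rw [Set.indicator_of_mem (Set.mem_Ioi.mpr hz), ← hf.valueLaw_Ioi,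
            ← setLIntegral_const, ← lintegral_indicator measurableSet_Ioi]
          refine lintegral_congr fun t => ?_
          simp [Set.indicator, hz]
        · simp [Set.indicator, hz]
    _ = ∫⁻ z in Set.Ioi r, H z * ENNReal.ofReal (1 - valueCDF f z) :=
        lintegral_indicator measurableSet_Ioi _
    _ = ∫⁻ z in Set.Ioi r, ((fun t => ENNReal.ofReal (f t)) *
          fun t => H t * ENNReal.ofReal (inverseHazard f t)) z := by
        refine setLIntegral_congr_fun measurableSet_Ioi fun z hz => ?_
        simp only [Pi.mul_apply]
        rw [mul_left_comm, ← ENNReal.ofReal_mul (hf.nonneg z), inverseHazard]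
        congr 2
        -- Where F = 1 both sides vanish, whatever `f` is; elsewhere `f` is positive and cancels.
        rcases (valueCDF_le_one f z).eq_or_lt with h1 | h1
        · simp [h1]
        · have := (hf.pos (t := z) ⟨hr.trans hz, h1⟩).ne'
          field_simp
    _ = _ := (setLIntegral_withDensity_eq_setLIntegral_mul _ hf.measurable.ennreal_ofReal
          (hH.mul ((measurable_const.sub hF).div hf.measurable).ennreal_ofReal)
          measurableSet_Ioi).symm

/-- A finite mean follows from the monotone hazard rate: E(θ - r)⁺ is the mean of the inverse hazard
rate over values above `r`, at most `inverseHazard f r`. -/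
lemma integrable_id (hf : IsRegularDensity f) {r : ℝ} (hr : 0 < r) :
    Integrable (fun t => t) (valueLaw f) := by
  have := hf.isProbabilityMeasure
  have h := hf.lintegral_lintegral_Ioo hr (H := fun _ => 1) measurable_const
  have hbound : ∫⁻ t in Set.Ioi r, 1 * ENNReal.ofReal (inverseHazard f t) ∂valueLaw f ≤
      ENNReal.ofReal (inverseHazard f r) := by
    calc _ ≤ ∫⁻ t in Set.Ioi r, ENNReal.ofReal (inverseHazard f r) ∂valueLaw f := by
          refine setLIntegral_mono measurable_const fun t ht => ?_
          rw [one_mul]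
          exact ENNReal.ofReal_le_ofReal (hf.inverseHazard_le hr (le_of_lt ht))
      _ ≤ ∫⁻ t, ENNReal.ofReal (inverseHazard f r) ∂valueLaw f := setLIntegral_le_lintegral _ _
      _ = _ := by simp
  refine ⟨measurable_id.aestronglyMeasurable, ?_⟩
  rw [hasFiniteIntegral_iff_ofReal (hf.ae_pos.mono fun t ht => ht.le)]
  calc ∫⁻ t, ENNReal.ofReal t ∂valueLaw f
      ≤ ∫⁻ t, (ENNReal.ofReal r + ∫⁻ z in Set.Ioo r t, 1) ∂valueLaw f := by
        refine lintegral_mono fun t => ?_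
        rw [setLIntegral_one, Real.volume_Ioo]
        calc ENNReal.ofReal t = ENNReal.ofReal (r + (t - r)) := by ring_nf
          _ ≤ _ := ENNReal.ofReal_add_le
    _ = ENNReal.ofReal r + ∫⁻ t, (∫⁻ z in Set.Ioo r t, 1) ∂valueLaw f := by
        rw [lintegral_add_left measurable_const]; simp
    _ < ⊤ := by
        rw [h]
        exact ENNReal.add_lt_top.mpr ⟨ENNReal.ofReal_lt_top, hbound.trans_lt ENNReal.ofReal_lt_top⟩

end IsRegularDensity

/-! ### Upper bound on the utilities under the proposed ranking -/

section CountAbove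

variable {n : ℕ} {ρ : Equiv.Perm (Fin n)} {S : ℕ → ℝ} {v u : Fin n → ℝ}

/-- The number of entries of `v` above `z`. -/
def countAbove (v : Fin n → ℝ) (z : ℝ) : ℕ := (Finset.univ.filter fun j => z < v j).card

lemma countAbove_antitone (v : Fin n → ℝ) : Antitone (countAbove v) := fun _ _ hab =>
  Finset.card_le_card (Finset.monotone_filter_right _ fun _ _ h => hab.trans_lt h)

/-- All entries above `z` are ranked no lower than `i`, so there are at most `ρ i + 1` of them,
ranks being counted from 0. A count of 0 is harmless, as truncated subtraction then gives the first
slot. -/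
lemma le_slot_countAbove (hS : Antitone S) {i : Fin n} {z : ℝ}
    (h : ∀ j, ρ i < ρ j → v j ≤ z) : S (ρ i) ≤ S (countAbove v z - 1) := by
  apply hS
  have hsub : (Finset.univ.filter fun j => z < v j) ⊆ topSet ρ (ρ i) := by
    intro j hj
    rw [mem_topSet]
    by_contra hlt
    exact absurd (h j (Fin.lt_def.mpr (not_le.mp hlt))) (not_le.mpr (by simpa using hj))
  have := Finset.card_le_card hsub
  rw [card_topSet ρ (ρ i).is_lt] at this
  unfold countAbove
  omega

/-- Utilities that satisfy the envy-freeness conditions between each advertiser and those ranked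
below it are bounded by the integral of the effects of the slots. -/
lemma utility_le_integral_countAbove (hS : Antitone S) (hS0 : ∀ k, 0 ≤ S k) (hv : ∀ i, 0 ≤ v i)
    (hle : ∀ i, u i ≤ S (ρ i) * v i)
    (horder : ∀ i j, ρ i < ρ j → 0 < S (ρ i) → v j ≤ v i)
    (henvy : ∀ i j, ρ i < ρ j → 0 < S (ρ i) → u i ≤ u j + S (ρ i) * (v i - v j)) (i : Fin n) :
    u i ≤ ∫ z in (0)..(v i), S (countAbove v z - 1) := by
  have hmono : Monotone fun z => S (countAbove v z - 1) := fun a b hab =>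
    hS (Nat.sub_le_sub_right (countAbove_antitone v hab) 1)
  have hInt : ∀ a b : ℝ, IntervalIntegrable (fun z => S (countAbove v z - 1)) volume a b :=
    fun a b => hmono.intervalIntegrable
  have hconst : ∀ i (a : ℝ), a ≤ v i → (∀ j, ρ i < ρ j → v j ≤ a) →
      S (ρ i) * (v i - a) ≤ ∫ z in a..(v i), S (countAbove v z - 1) := by
    intro i a hai h
    calc S (ρ i) * (v i - a) = ∫ z in a..(v i), S (ρ i) := by simp [mul_comm]
      _ ≤ _ := intervalIntegral.integral_mono_on hai intervalIntegrable_const (hInt _ _)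
          fun z hz => le_slot_countAbove hS fun j hj => (h j hj).trans hz.1
  -- The induction runs upwards from the bottom of the ranking.
  induction hk : n - (ρ i : ℕ) using Nat.strong_induction_on generalizing i with
  | _ k ih =>
    rcases (hS0 (ρ i)).eq_or_lt with h0 | h0
    · have := hle i
      rw [← h0, zero_mul] at this
      exact this.trans (intervalIntegral.integral_nonneg (hv i) fun z _ => hS0 _)
    rcases (Finset.univ.filter fun j => ρ i < ρ j).eq_empty_or_nonempty with he | hne
    · have := hconst i 0 (hv i) fun j hj =>
        absurd hj (Finset.filter_eq_empty_iff.mp he (Finset.mem_univ j))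
      rw [sub_zero] at this
      exact (hle i).trans this
    -- The comparison is with the largest `v` below `i`, not with the next position: the order is
    -- arbitrary where effects vanish. No advertiser below `i` exceeds `v j`, so `S (ρ i)` bounds
    -- the integrand from below on [v j, v i].
    · obtain ⟨j, hj, hmax⟩ := Finset.exists_max_image _ v hne
      have hij : ρ i < ρ j := by simpa using hj
      have hj1 := ih (n - (ρ j : ℕ))
        (by have := Fin.lt_def.mp hij; have := (ρ j).is_lt; omega) j rfl
      have hj2 := hconst i (v j) (horder i j hij h0) fun l hl => hmax l (by simpa using hl)
      rw [← intervalIntegral.integral_add_adjacent_intervals (hInt 0 (v j)) (hInt _ _)]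
      linarith [henvy i j hij h0]

end CountAbove

/-- The number of competitors of advertiser `i` with a value per impression, net of the reserve
price, above `z`. -/
def numAbove {n : ℕ} (r : ℝ) (p : Types n) (i : Fin n) (z : ℝ) : ℕ :=
  (Finset.univ.filter fun j => j ≠ i ∧ z < proposedRanking r (p.1 j) (p.2 j)).card

lemma numAbove_eq {n : ℕ} {r : ℝ} {p : Types n} {i : Fin n} {z : ℝ}
    (hz : z < proposedRanking r (p.1 i) (p.2 i)) :
    numAbove r p i z = countAbove (fun j => proposedRanking r (p.1 j) (p.2 j)) z - 1 := by
  unfold numAbove countAbove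
  rw [← Finset.card_erase_of_mem (Finset.mem_filter.mpr ⟨Finset.mem_univ i, hz⟩)]
  congr 1
  ext j
  simp

lemma numAbove_antitone {n : ℕ} (r : ℝ) (p : Types n) (i : Fin n) : Antitone (numAbove r p i) :=
  fun _ _ hab => Finset.card_le_card
    (Finset.monotone_filter_right _ fun _ _ h => ⟨h.1, hab.trans_lt h.2⟩)

namespace Outcome

variable {n m : ℕ} {s : Fin m → ℝ} {r : ℝ} {p : Types n} {o : Outcome n}

/-- The utility per impression of advertiser `i`. -/
def utility (y : ℝ → ℝ → ℝ) (s : Fin m → ℝ) (p : Types n) (o : Outcome n) (i : Fin n) : ℝ :=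
  (p.1 i - o.priceAt y p.2 (o.rank i) (p.2 i)) * p.2 i * o.alloc y s p.2 i

lemma utility_proposed (hw : ∀ i, 0 < p.2 i) (i : Fin n) :
    o.utility (proposedRanking r) s p i =
      ((p.1 i - r) * p.2 i - o.nextScore (proposedRanking r) p.2 (o.rank i)) *
        o.alloc (proposedRanking r) s p.2 i := by
  have hwi := (hw i).ne'
  rw [utility, priceAt, price_proposedRanking
    (nextScore_nonneg (hasReservePrice_proposedRanking r) hw _) (hw i)]
  congr 1
  field_simp
  ring

lemma IsSNE.utility_nonneg' {y : ℝ → ℝ → ℝ} (hw : ∀ i, 0 < p.2 i) (ho : o.IsSNE y s p)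
    (i : Fin n) : 0 ≤ o.utility y s p i := by
  rw [utility, mul_right_comm]
  exact mul_nonneg (ho.utility_nonneg i) (hw i).le

/-- The general bound applies to the values net of the reserve. Counting competitors only makes the
integrand independent of the value of `i`. -/
lemma IsSNE.utility_le_integral (hs : StrictAnti s) (hs_pos : ∀ k, 0 < s k) (hw : ∀ i, 0 < p.2 i)
    (hne : ∀ i, p.1 i ≠ r) (ho : o.IsSNE (proposedRanking r) s p) (i : Fin n) :
    o.utility (proposedRanking r) s p i ≤
      ∫ z in (0)..(proposedRanking r (p.1 i) (p.2 i)), slotEffect s (numAbove r p i z) := by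
  have hy := hasReservePrice_proposedRanking r
  have hS := slotEffect_antitone hs hs_pos
  have hS0 := slotEffect_nonneg hs_pos
  have hv : ∀ j, 0 ≤ proposedRanking r (p.1 j) (p.2 j) := fun j => hy.nonneg (hw j)
  have hu : ∀ j, 0 ≤ o.utility (proposedRanking r) s p j := fun j => ho.utility_nonneg' hw j
  have hhigh : ∀ j, r < p.1 j →
      proposedRanking r (p.1 j) (p.2 j) = (p.1 j - r) * p.2 j := fun j hj => by
    rw [proposedRanking, max_eq_left (sub_nonneg.mpr hj.le)]
  have hlow : ∀ j, p.1 j < r → proposedRanking r (p.1 j) (p.2 j) = 0 := fun j hj => by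
    rw [proposedRanking, max_eq_right (sub_nonpos.mpr hj.le), zero_mul]
  have hulow : ∀ j, p.1 j < r → o.utility (proposedRanking r) s p j = 0 := fun j hj => by
    rw [utility, ho.alloc_eq_zero hy hs_pos hw hj, mul_zero]
  have huhigh : ∀ j, r < p.1 j → o.utility (proposedRanking r) s p j =
      (proposedRanking r (p.1 j) (p.2 j) - o.nextScore (proposedRanking r) p.2 (o.rank j)) *
        slotEffect s (o.rank j) := fun j hj => by
    rw [utility_proposed hw, ho.alloc_eq_slotEffect hy hs_pos hw hj, hhigh j hj]
  have key := utility_le_integral_countAbove (ρ := o.rank) (S := slotEffect s)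
    (v := fun j => proposedRanking r (p.1 j) (p.2 j))
    (u := fun j => o.utility (proposedRanking r) s p j) hS hS0 hv ?_ ?_ ?_ i
  · refine key.trans (intervalIntegral.integral_mono_on_of_le_Ioo (hv i) ?_ ?_ fun z hz => ?_)
    · refine Monotone.intervalIntegrable fun a b hab => ?_
      exact hS (Nat.sub_le_sub_right (countAbove_antitone _ hab) 1)
    · exact Monotone.intervalIntegrable fun a b hab => hS (numAbove_antitone r p i hab)
    · rw [numAbove_eq hz.2]
  · intro j
    rcases lt_or_gt_of_ne (hne j) with hj | hj
    · simp only [hulow j hj]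
      exact mul_nonneg (hS0 _) (hv j)
    · simp only [huhigh j hj]
      have := nextScore_nonneg (o := o) hy hw (o.rank j)
      nlinarith [hS0 (o.rank j)]
  · intro j l hjl hpos
    exact ho.proposed_order hs hs_pos hw hne hjl hpos
  · intro j l hjl hpos
    have hord := ho.proposed_order hs hs_pos hw hne hjl hpos
    rcases lt_or_gt_of_ne (hne j) with hj | hj
    · simp only [hulow j hj]
      have := mul_nonneg hpos.le (sub_nonneg.mpr hord)
      linarith [hu l]
    · have henvy : (proposedRanking r (p.1 l) (p.2 l) -
          o.nextScore (proposedRanking r) p.2 (o.rank j)) * slotEffect s (o.rank j) ≤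
          o.utility (proposedRanking r) s p l := by
        -- Below the reserve the net value is truncated at 0, so the equilibrium condition of `l`
        -- does not apply literally; the left side is then nonpositive anyway.
        rcases lt_or_gt_of_ne (hne l) with hl | hl
        · rw [hlow l hl]
          have := nextScore_nonneg (o := o) hy hw (o.rank j)
          nlinarith [hu l]
        · rw [hhigh l hl, utility_proposed hw]
          exact ho.proposed hw l (o.rank j)
      simp only [huhigh j hj]
      linarith

/-- The bound on the utilities as an integral over lower values of advertiser `i`. -/
lemma IsSNE.utility_le_lintegral (hs : StrictAnti s) (hs_pos : ∀ k, 0 < s k)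
    (hw : ∀ i, 0 < p.2 i) (hne : ∀ i, p.1 i ≠ r) (ho : o.IsSNE (proposedRanking r) s p)
    (i : Fin n) :
    ENNReal.ofReal (o.utility (proposedRanking r) s p i) ≤
      ∫⁻ t in Set.Ioo r (p.1 i),
        ENNReal.ofReal (p.2 i * slotEffect s (numAbove r p i ((t - r) * p.2 i))) := by
  have hy := hasReservePrice_proposedRanking r
  have hS := slotEffect_antitone hs hs_pos
  have hS0 := slotEffect_nonneg hs_pos
  rcases lt_or_gt_of_ne (hne i) with hi | hi
  · rw [utility, ho.alloc_eq_zero hy hs_pos hw hi, mul_zero, ENNReal.ofReal_zero]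
    exact zero_le
  have h1 := ho.utility_le_integral hs hs_pos hw hne i
  rw [proposedRanking, max_eq_left (sub_nonneg.mpr hi.le)] at h1
  have hmono : Monotone fun t => p.2 i * slotEffect s (numAbove r p i ((t - r) * p.2 i)) :=
    fun a b hab => mul_le_mul_of_nonneg_left (hS (numAbove_antitone r p i
      (mul_le_mul_of_nonneg_right (sub_le_sub_right hab r) (hw i).le))) (hw i).le
  -- Substitution z = (t - r)w, from values per impression to values per click.
  have h2 := intervalIntegral.integral_comp_mul_sub (a := r) (b := p.1 i)
    (fun z => slotEffect s (numAbove r p i z)) (hw i).ne' (p.2 i * r)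
  have h3 : ∫ z in (0)..((p.1 i - r) * p.2 i), slotEffect s (numAbove r p i z) =
      ∫ t in r..(p.1 i), p.2 i * slotEffect s (numAbove r p i ((t - r) * p.2 i)) := by
    rw [intervalIntegral.integral_const_mul]
    have : ∀ t, (t - r) * p.2 i = p.2 i * t - p.2 i * r := fun t => by ring
    simp only [this]
    rw [h2, sub_self, smul_eq_mul, mul_inv_cancel_left₀ (hw i).ne']
  rw [h3, intervalIntegral.integral_of_le hi.le, integral_Ioc_eq_integral_Ioo] at h1
  rw [← ofReal_integral_eq_lintegral_ofReal]
  · exact ENNReal.ofReal_le_ofReal h1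
  · have := hmono.intervalIntegrable (μ := volume) (a := r) (b := p.1 i)
    rw [intervalIntegrable_iff_integrableOn_Ioo_of_le hi.le] at this
    exact this
  · exact Filter.Eventually.of_forall fun t => mul_nonneg (hw i).le (hS0 _)

/-- Without ties, an advertiser gets at least the slot that its place in the order of the values per
impression entitles it to. -/
lemma IsSNE.slotEffect_numAbove_le (hs : StrictAnti s) (hs_pos : ∀ k, 0 < s k)
    (hw : ∀ i, 0 < p.2 i) (hne : ∀ i, p.1 i ≠ r) (ho : o.IsSNE (proposedRanking r) s p)
    {i : Fin n} (hi : r < p.1 i)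
    (hties : ∀ j, j ≠ i →
      proposedRanking r (p.1 i) (p.2 i) ≠ proposedRanking r (p.1 j) (p.2 j)) :
    slotEffect s (numAbove r p i ((p.1 i - r) * p.2 i)) ≤
      o.alloc (proposedRanking r) s p.2 i := by
  have hy := hasReservePrice_proposedRanking r
  have hv : proposedRanking r (p.1 i) (p.2 i) = (p.1 i - r) * p.2 i := by
    rw [proposedRanking, max_eq_left (sub_nonneg.mpr hi.le)]
  rw [ho.alloc_eq_slotEffect hy hs_pos hw hi, ← hv]
  by_contra hlt
  push Not at hlt
  set N := numAbove r p i (proposedRanking r (p.1 i) (p.2 i)) with hN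
  have hNi : N < o.rank i := by
    by_contra h
    exact absurd (slotEffect_antitone hs hs_pos (not_lt.mp h)) (not_le.mpr hlt)
  have hcard := card_topSet o.rank (hNi.trans (o.rank i).is_lt)
  -- Pigeonhole: the first `N + 1` positions are all above `i`, but only `N` competitors exceed it,
  -- so some `j` ranked above `i` does not.
  obtain ⟨j, hj, hj'⟩ : ∃ j ∈ topSet o.rank N, j ∉ Finset.univ.filter fun j => j ≠ i ∧
      proposedRanking r (p.1 i) (p.2 i) < proposedRanking r (p.1 j) (p.2 j) := by
    refine Finset.exists_mem_notMem_of_card_lt_card ?_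
    rw [hcard]
    exact Nat.lt_succ_of_le hN.ge
  rw [mem_topSet] at hj
  have hji : j ≠ i := fun h => by subst h; omega
  have hpos : 0 < slotEffect s (o.rank j) :=
    ((slotEffect_nonneg hs_pos _).trans_lt hlt).trans_le (slotEffect_antitone hs hs_pos hj)
  have h1 := ho.proposed_order hs hs_pos hw hne (Fin.lt_def.mpr (hj.trans_lt hNi)) hpos
  refine hj' (Finset.mem_filter.mpr ⟨Finset.mem_univ j, hji, lt_of_le_of_ne h1 (hties j hji)⟩)

end Outcome

/-! ### Resampling one value -/

/-- Replacing one coordinate of an i.i.d. vector by an independent copy preserves its law. -/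
lemma measurePreserving_update {n : ℕ} (μ : Measure ℝ) [IsProbabilityMeasure μ] (i : Fin n) :
    MeasurePreserving (fun x : ℝ × (Fin n → ℝ) => Function.update x.2 i x.1)
      (μ.prod (Measure.pi fun _ => μ)) (Measure.pi fun _ => μ) := by
  have hmeas : Measurable fun x : ℝ × (Fin n → ℝ) => Function.update x.2 i x.1 := by
    refine measurable_pi_lambda _ fun j => ?_
    by_cases hj : j = i
    · subst hj
      simpa using measurable_fst
    · simpa [hj, Function.comp_def] using (measurable_pi_apply j).comp measurable_snd
  refine ⟨hmeas, (Measure.pi_eq fun t ht => ?_).symm⟩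
  rw [Measure.map_apply hmeas (MeasurableSet.univ_pi ht)]
  -- The preimage of a box is again a box: the side `t i` moves to the fresh copy, and the old
  -- coordinate `i` becomes free.
  have hpre : (fun x : ℝ × (Fin n → ℝ) => Function.update x.2 i x.1) ⁻¹' Set.univ.pi t =
      t i ×ˢ Set.univ.pi (Function.update t i Set.univ) := by
    ext ⟨a, b⟩
    simp only [Set.mem_preimage, Set.mem_pi, Set.mem_univ, true_imp_iff, Set.mem_prod]
    constructor
    · intro h
      refine ⟨by simpa using h i, fun j => ?_⟩
      by_cases hj : j = i
      · subst hj; simp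
      · simpa [hj] using h j
    · rintro ⟨h1, h2⟩ j
      by_cases hj : j = i
      · subst hj; simpa using h1
      · simpa [hj] using h2 j
  rw [hpre, Measure.prod_prod, Measure.pi_pi, ← Finset.mul_prod_erase _ _ (Finset.mem_univ i),
    ← Finset.mul_prod_erase (a := i) Finset.univ (fun j => μ (t j)) (Finset.mem_univ i)]
  simp only [Function.update_self, measure_univ, one_mul]
  congr 1
  refine Finset.prod_congr rfl fun j hj => ?_
  rw [Function.update_of_ne (Finset.ne_of_mem_erase hj)]

/-- The types with the value of advertiser `i` replaced by `t`. -/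
def replaceValue {n : ℕ} (i : Fin n) (t : ℝ) (p : Types n) : Types n :=
  (Function.update p.1 i t, p.2)

lemma numAbove_replaceValue {n : ℕ} (r : ℝ) (i : Fin n) (t : ℝ) (p : Types n) (z : ℝ) :
    numAbove r (replaceValue i t p) i z = numAbove r p i z := by
  unfold numAbove
  refine congrArg Finset.card (Finset.filter_congr fun j _ => and_congr_right fun hj => ?_)
  simp [replaceValue, Function.update_of_ne hj]

section TypeLaw

variable {n m : ℕ} {f : ℝ → ℝ} {ν : Measure (Fin n → ℝ)} [IsProbabilityMeasure ν]

lemma measurePreserving_replaceValue [IsProbabilityMeasure (valueLaw f)] (i : Fin n) :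
    MeasurePreserving (fun x : ℝ × Types n => replaceValue i x.1 x.2)
      ((valueLaw f).prod (typeLaw f ν)) (typeLaw f ν) :=
  ((measurePreserving_update (valueLaw f) i).prod (MeasurePreserving.id ν)).comp
    (measurePreserving_prodAssoc (valueLaw f) (Measure.pi fun _ => valueLaw f) ν).symm

instance [IsProbabilityMeasure (valueLaw f)] : IsProbabilityMeasure (typeLaw f ν) := by
  unfold typeLaw; infer_instance

lemma lintegral_replaceValue [IsProbabilityMeasure (valueLaw f)] (i : Fin n)
    {G : Types n → ENNReal} (hG : Measurable G) :
    ∫⁻ p, G p ∂typeLaw f ν =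
      ∫⁻ p, ∫⁻ t, G (replaceValue i t p) ∂valueLaw f ∂typeLaw f ν := by
  have h := measurePreserving_replaceValue (f := f) (ν := ν) i
  rw [← h.lintegral_comp hG]
  exact lintegral_prod_symm _ (hG.comp h.measurable).aemeasurable

/-! ### Almost sure properties of the types -/

lemma ae_value [IsProbabilityMeasure (valueLaw f)] {q : ℝ → Prop}
    (h : ∀ᵐ t ∂valueLaw f, q t) : ∀ᵐ p ∂typeLaw f ν, ∀ i, q (p.1 i) := by
  rw [ae_all_iff]
  intro i
  exact ((measurePreserving_eval (fun _ : Fin n => valueLaw f) i).comp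
    measurePreserving_fst).quasiMeasurePreserving.ae h

lemma ae_relevance [IsProbabilityMeasure (valueLaw f)] {q : (Fin n → ℝ) → Prop}
    (h : ∀ᵐ w ∂ν, q w) : ∀ᵐ p ∂typeLaw f ν, q p.2 :=
  (measurePreserving_snd (μ := Measure.pi fun _ : Fin n => valueLaw f)
    (ν := ν)).quasiMeasurePreserving.ae h

lemma measurable_value (i : Fin n) : Measurable fun p : Types n => p.1 i :=
  (measurable_pi_apply i).comp measurable_fst

lemma measurable_relevance (i : Fin n) : Measurable fun p : Types n => p.2 i :=
  (measurable_pi_apply i).comp measurable_snd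

lemma measurable_proposedRanking (r : ℝ) :
    Measurable fun x : ℝ × ℝ => proposedRanking r x.1 x.2 :=
  ((measurable_fst.sub_const r).max measurable_const).mul measurable_snd

lemma measurable_standardRanking (r : ℝ) :
    Measurable fun x : ℝ × ℝ => standardRanking r x.1 x.2 :=
  Measurable.ite (measurableSet_le measurable_const measurable_fst)
    (measurable_fst.mul measurable_snd) measurable_const

/-- Given everything else, a tie above the reserve pins the value of `i` to one point, which has no
mass. Below the reserve all scores are 0 and ties do occur. -/
lemma ae_no_ties [IsProbabilityMeasure (valueLaw f)] (r : ℝ) (hw : ∀ᵐ w ∂ν, ∀ i, 0 < w i) :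
    ∀ᵐ p ∂typeLaw f ν, ∀ i j, j ≠ i → r < p.1 i →
      proposedRanking r (p.1 i) (p.2 i) ≠ proposedRanking r (p.1 j) (p.2 j) := by
  simp only [ae_all_iff]
  intro i j hji
  set A : Set (Types n) := {p | (r < p.1 i ∧ 0 < p.2 i) ∧
    proposedRanking r (p.1 i) (p.2 i) = proposedRanking r (p.1 j) (p.2 j)} with hA
  have hAm : MeasurableSet A := by
    refine MeasurableSet.inter (MeasurableSet.inter
      (measurableSet_lt measurable_const (measurable_value i))
      (measurableSet_lt measurable_const (measurable_relevance i))) (measurableSet_eq_fun ?_ ?_)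
    · exact (measurable_proposedRanking r).comp ((measurable_value i).prodMk (measurable_relevance i))
    · exact (measurable_proposedRanking r).comp ((measurable_value j).prodMk (measurable_relevance j))
  have hA0 : typeLaw f ν A = 0 := by
    rw [← lintegral_indicator_one hAm,
      lintegral_replaceValue i (measurable_one.indicator hAm)]
    refine (lintegral_congr fun p => ?_).trans lintegral_zero
    refine (lintegral_congr_ae ?_).trans lintegral_zero
    filter_upwards [ae_valueLaw_ne f (r + proposedRanking r (p.1 j) (p.2 j) / p.2 i)] with t ht
    refine Set.indicator_of_notMem (fun hmem => ht ?_) _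
    obtain ⟨⟨h1, h2⟩, h3⟩ := hmem
    simp only [replaceValue, Function.update_self, Function.update_of_ne hji] at h1 h2 h3
    rw [← h3, proposedRanking, max_eq_left (sub_nonneg.mpr h1.le),
      mul_div_cancel_right₀ _ h2.ne']
    ring
  have h := measure_eq_zero_iff_ae_notMem.mp hA0
  filter_upwards [h, ae_relevance (f := f) hw] with p hp hwp hi heq
  exact hp ⟨⟨hi, hwp i⟩, heq⟩

/-! ### The expected utilities -/

lemma measurable_numAbove (r : ℝ) (i : Fin n) :
    Measurable fun x : Types n × ℝ => numAbove r x.1 i x.2 := by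
  simp only [numAbove, Finset.card_filter]
  refine Finset.measurable_sum _ fun j _ => Measurable.ite ?_ measurable_const measurable_const
  refine MeasurableSet.inter (MeasurableSet.const _) (measurableSet_lt measurable_snd ?_)
  exact (measurable_proposedRanking r).comp (((measurable_value j).comp measurable_fst).prodMk
    ((measurable_relevance j).comp measurable_fst))

/-- The effect per impression of the slot that advertiser `i` gets if its value is `t`. -/
def entitlement (s : Fin m → ℝ) (r : ℝ) (i : Fin n) (x : Types n × ℝ) : ENNReal :=
  ENNReal.ofReal (x.1.2 i * slotEffect s (numAbove r x.1 i ((x.2 - r) * x.1.2 i)))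

lemma measurable_entitlement (s : Fin m → ℝ) (r : ℝ) (i : Fin n) :
    Measurable (entitlement s r i) := by
  have hw : Measurable fun x : Types n × ℝ => x.1.2 i :=
    (measurable_relevance i).comp measurable_fst
  refine (hw.mul ((Measurable.of_discrete (f := slotEffect s)).comp
    ((measurable_numAbove r i).comp (measurable_fst.prodMk ?_)))).ennreal_ofReal
  exact (measurable_snd.sub_const r).mul hw

lemma entitlement_replaceValue (s : Fin m → ℝ) (r : ℝ) (i : Fin n) (t z : ℝ) (p : Types n) :
    entitlement s r i (replaceValue i t p, z) = entitlement s r i (p, z) := by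
  simp only [entitlement, numAbove_replaceValue]
  rfl

lemma IsRegularDensity.measurable_inverseHazard (hf : IsRegularDensity f) :
    Measurable (inverseHazard f) :=
  (measurable_const.sub (valueCDF_mono f).measurable).div hf.measurable

/-- Resampling the value of `i` leaves its entitlement function unchanged, so the one-dimensional
integration by parts applies with all other types fixed. -/
lemma lintegral_lintegral_entitlement (hf : IsRegularDensity f) (s : Fin m → ℝ) {r : ℝ}
    (hr : 0 < r) (i : Fin n) :
    ∫⁻ p, (∫⁻ t in Set.Ioo r (p.1 i), entitlement s r i (p, t)) ∂typeLaw f ν =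
      ∫⁻ p, {p : Types n | r < p.1 i}.indicator (fun p => entitlement s r i (p, p.1 i) *
        ENNReal.ofReal (inverseHazard f (p.1 i))) p ∂typeLaw f ν := by
  have := hf.isProbabilityMeasure
  have hE := measurable_entitlement (n := n) s r i
  have hL : Measurable fun p : Types n => ∫⁻ t in Set.Ioo r (p.1 i), entitlement s r i (p, t) := by
    have hset : MeasurableSet {x : Types n × ℝ | r < x.2 ∧ x.2 < x.1.1 i} :=
      (measurableSet_lt measurable_const measurable_snd).inter
        (measurableSet_lt measurable_snd ((measurable_value i).comp measurable_fst))
    convert (hE.indicator hset).lintegral_prod_right' (ν := volume) using 2 with p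
    rw [← lintegral_indicator measurableSet_Ioo]
    rfl
  have hR : Measurable ({p : Types n | r < p.1 i}.indicator
      (fun p => entitlement s r i (p, p.1 i) * ENNReal.ofReal (inverseHazard f (p.1 i)))) :=
    ((hE.comp (measurable_id.prodMk (measurable_value i))).mul
      (hf.measurable_inverseHazard.comp (measurable_value i)).ennreal_ofReal).indicator
      (measurableSet_lt measurable_const (measurable_value i))
  rw [lintegral_replaceValue i hL, lintegral_replaceValue i hR]
  refine lintegral_congr fun p => ?_
  simp only [entitlement_replaceValue]
  have h := hf.lintegral_lintegral_Ioo hr (H := fun t => entitlement s r i (p, t))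
    (hE.comp (measurable_const.prodMk measurable_id))
  rw [← lintegral_indicator measurableSet_Ioi] at h
  simp only [replaceValue, Function.update_self]
  rw [h]
  refine lintegral_congr fun t => ?_
  simp only [Set.indicator, Set.mem_Ioi, Set.mem_ofPred_eq, Function.update_self]
  congr 2
  exact (entitlement_replaceValue s r i t t p).symm

/-- The right side is the information rent of the allocation; equilibrium utilities cannot exceed it
on average. -/
lemma lintegral_utility_le (hf : IsRegularDensity f) {s : Fin m → ℝ} (hs : StrictAnti s)
    (hs_pos : ∀ k, 0 < s k) {r : ℝ} (hr : 0 < r) (hw : ∀ᵐ w ∂ν, ∀ i, 0 < w i)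
    {o : Types n → Outcome n} (ho : ∀ᵐ p ∂typeLaw f ν, (o p).IsSNE (proposedRanking r) s p)
    (i : Fin n) :
    ∫⁻ p, ENNReal.ofReal ((o p).utility (proposedRanking r) s p i) ∂typeLaw f ν ≤
      ∫⁻ p, ENNReal.ofReal (inverseHazard f (p.1 i) * p.2 i *
        (o p).alloc (proposedRanking r) s p.2 i) ∂typeLaw f ν := by
  have := hf.isProbabilityMeasure
  have hne := ae_value (ν := ν) (ae_valueLaw_ne f r)
  have hwp := ae_relevance (f := f) hw
  calc _ ≤ ∫⁻ p, (∫⁻ t in Set.Ioo r (p.1 i), entitlement s r i (p, t)) ∂typeLaw f ν := by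
        refine lintegral_mono_ae ?_
        filter_upwards [ho, hne, hwp] with p hop hnep hwp
        exact hop.utility_le_lintegral hs hs_pos hwp hnep i
    _ = _ := lintegral_lintegral_entitlement hf s hr i
    _ ≤ _ := by
        refine lintegral_mono_ae ?_
        filter_upwards [ho, hne, hwp, ae_no_ties (f := f) r hw] with p hop hnep hwp hties
        by_cases hi : r < p.1 i
        · rw [Set.indicator_of_mem (show p ∈ {p : Types n | r < p.1 i} from hi), entitlement,
            ← ENNReal.ofReal_mul (mul_nonneg (hwp i).le (slotEffect_nonneg hs_pos _))]
          refine ENNReal.ofReal_le_ofReal ?_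
          have h1 := hop.slotEffect_numAbove_le hs hs_pos hwp hnep hi
            fun j hj => hties i j hj hi
          have h2 := mul_le_mul_of_nonneg_left h1
            (mul_nonneg (hf.inverseHazard_nonneg (p.1 i)) (hwp i).le)
          linarith
        · rw [Set.indicator_of_notMem (show p ∉ {p : Types n | r < p.1 i} from hi)]
          exact zero_le

end TypeLaw

section Pointwise

variable {n m : ℕ} {s : Fin m → ℝ} {f : ℝ → ℝ} {r : ℝ} {p : Types n}

/-! ### Comparison of the virtual surpluses for given types -/

/-- The virtual value per impression of the advertisers with values above the reserve price. -/
def virtualWeight (f : ℝ → ℝ) (r : ℝ) (p : Types n) (i : Fin n) : ℝ :=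
  if r < p.1 i then virtualValue f (p.1 i) * p.2 i else 0

lemma virtualWeight_of_lt {i : Fin n} (hi : p.1 i < r) : virtualWeight f r p i = 0 :=
  if_neg hi.not_gt

lemma virtualWeight_of_gt {i : Fin n} (hi : r < p.1 i) :
    virtualWeight f r p i = virtualValue f (p.1 i) * p.2 i :=
  if_pos hi

/-- Zero weights below the reserve allow the allocation to be replaced by the effects of the ranks,
so that two permutations can be compared with common weights. -/
lemma Outcome.IsSNE.sum_virtualValue_eq {y : ℝ → ℝ → ℝ} (hy : HasReservePrice y r)
    (hs_pos : ∀ k, 0 < s k) (hw : ∀ i, 0 < p.2 i) (hne : ∀ i, p.1 i ≠ r) {o : Outcome n}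
    (ho : o.IsSNE y s p) :
    ∑ i, virtualValue f (p.1 i) * p.2 i * o.alloc y s p.2 i =
      ∑ i, virtualWeight f r p i * slotEffect s (o.rank i) := by
  refine Finset.sum_congr rfl fun i _ => ?_
  rcases lt_or_gt_of_ne (hne i) with hi | hi
  · rw [ho.alloc_eq_zero hy hs_pos hw hi, virtualWeight_of_lt hi, mul_zero, zero_mul]
  · rw [ho.alloc_eq_slotEffect hy hs_pos hw hi, virtualWeight_of_gt hi]

/-- The advertiser in the first position has a value above the reserve price if any one has. -/
lemma Outcome.IsSNE.lt_value_of_rank_eq_zero {y : ℝ → ℝ → ℝ} (hy : HasReservePrice y r)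
    (hm : 0 < m) (hs : StrictAnti s) (hs_pos : ∀ k, 0 < s k) (hw : ∀ i, 0 < p.2 i)
    (hne : ∀ i, p.1 i ≠ r) {o : Outcome n} (ho : o.IsSNE y s p) {i l : Fin n}
    (hi : r < p.1 i) (hl : (o.rank l : ℕ) = 0) : r < p.1 l := by
  rcases lt_or_gt_of_ne (hne l) with h | h
  · have hil : i ≠ l := fun e => by subst e; exact absurd hi h.not_gt
    have hlt : o.rank l < o.rank i := by
      have : (o.rank i : ℕ) ≠ o.rank l := fun e => hil (o.rank.injective (Fin.ext e))
      rw [Fin.lt_def]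
      omega
    have := ho.slotEffect_eq_zero hy hs hs_pos hw hi h hlt
    rw [hl] at this
    exact absurd this (slotEffect_zero_pos hm hs_pos).ne'
  · exact h

variable {o₁ o₂ : Outcome n}

/-- Where the equilibria under the two rankings order a pair of advertisers differently, the one
under the proposed ranking orders it according to the virtual values. -/
lemma virtualWeight_le (hf : IsRegularDensity f) (hs : StrictAnti s) (hs_pos : ∀ k, 0 < s k)
    (hr_pos : 0 < r)
    (hr : ∀ t, r ≤ t → valueCDF f t < 1 →
      r ≤ t - virtualValue f t / deriv (virtualValue f) t)
    (hw : ∀ i, 0 < p.2 i) (hne : ∀ i, p.1 i ≠ r) (hF : ∀ i, valueCDF f (p.1 i) < 1)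
    (h₁ : o₁.IsSNE (proposedRanking r) s p) (h₂ : o₂.IsSNE (standardRanking r) s p)
    (k : ℕ) (i j : Fin n) (hk : slotEffect s (k + 1) < slotEffect s k)
    (h₁i : (o₁.rank i : ℕ) ≤ k) (h₁j : k < o₁.rank j)
    (h₂j : (o₂.rank j : ℕ) ≤ k) (h₂i : k < o₂.rank i) :
    virtualWeight f r p j ≤ virtualWeight f r p i := by
  have hk0 : 0 < slotEffect s k := (slotEffect_nonneg hs_pos _).trans_lt hk
  have hpos₁ : 0 < slotEffect s (o₁.rank i) := hk0.trans_le (slotEffect_antitone hs hs_pos h₁i)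
  have hpos₂ : 0 < slotEffect s (o₂.rank j) := hk0.trans_le (slotEffect_antitone hs hs_pos h₂j)
  have hlt₁ : o₁.rank i < o₁.rank j := Fin.lt_def.mpr (h₁i.trans_lt h₁j)
  have hlt₂ : o₂.rank j < o₂.rank i := Fin.lt_def.mpr (h₂j.trans_lt h₂i)
  rcases lt_or_gt_of_ne (hne i) with hi | hi <;> rcases lt_or_gt_of_ne (hne j) with hj | hj
  · rw [virtualWeight_of_lt hi, virtualWeight_of_lt hj]
  · exact absurd (h₁.slotEffect_eq_zero (hasReservePrice_proposedRanking r) hs hs_pos hw hj hi hlt₁)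
      hpos₁.ne'
  · exact absurd (h₂.slotEffect_eq_zero (hasReservePrice_standardRanking hr_pos) hs hs_pos hw hi hj
      hlt₂) hpos₂.ne'
  · rw [virtualWeight_of_gt hi, virtualWeight_of_gt hj]
    have hord := h₁.proposed_order hs hs_pos hw hne hlt₁ hpos₁
    rw [proposedRanking, proposedRanking, max_eq_left (sub_nonneg.mpr hi.le),
      max_eq_left (sub_nonneg.mpr hj.le)] at hord
    refine hf.virtualValue_mul_le_mul hr_pos hr hj (hF i) (hw i) ?_ hord
    -- If `j` were less relevant, the standard order would give θ_i w_i ≤ θ_j w_j; subtracting r w_i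
    -- > r w_j contradicts the proposed order.
    by_contra hwlt
    push Not at hwlt
    have := h₂.standard_order hr_pos hs hs_pos hw hj hi hlt₂ hpos₂ hwlt.le
    nlinarith [mul_pos hr_pos (sub_pos.mpr hwlt)]

lemma sum_virtualValue_le (hf : IsRegularDensity f) (hs : StrictAnti s) (hs_pos : ∀ k, 0 < s k)
    (hr_pos : 0 < r)
    (hr : ∀ t, r ≤ t → valueCDF f t < 1 →
      r ≤ t - virtualValue f t / deriv (virtualValue f) t)
    (hw : ∀ i, 0 < p.2 i) (hne : ∀ i, p.1 i ≠ r) (hF : ∀ i, valueCDF f (p.1 i) < 1)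
    (h₁ : o₁.IsSNE (proposedRanking r) s p) (h₂ : o₂.IsSNE (standardRanking r) s p) :
    ∑ i, virtualValue f (p.1 i) * p.2 i * o₂.alloc (standardRanking r) s p.2 i ≤
      ∑ i, virtualValue f (p.1 i) * p.2 i * o₁.alloc (proposedRanking r) s p.2 i := by
  rw [h₁.sum_virtualValue_eq (hasReservePrice_proposedRanking r) hs_pos hw hne,
    h₂.sum_virtualValue_eq (hasReservePrice_standardRanking hr_pos) hs_pos hw hne]
  exact sum_mul_rank_le (slotEffect_antitone hs hs_pos)
    (virtualWeight_le hf hs hs_pos hr_pos hr hw hne hF h₁ h₂)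

/-- Types for which the two rankings put different advertisers first: only `i` and `j` have values
above the reserve price, and their order depends on whether it is subtracted. -/
def IsReversal (r : ℝ) (i j : Fin n) (p : Types n) : Prop :=
  r < p.1 i ∧ r < p.1 j ∧ (∀ l, l ≠ i → l ≠ j → p.1 l < r) ∧ p.2 i < p.2 j ∧
    p.1 i * p.2 i < p.1 j * p.2 j ∧ (p.1 j - r) * p.2 j < (p.1 i - r) * p.2 i

lemma sum_virtualValue_lt (hm : 0 < m) (hf : IsRegularDensity f) (hs : StrictAnti s)
    (hs_pos : ∀ k, 0 < s k) (hr_pos : 0 < r)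
    (hr : ∀ t, r ≤ t → valueCDF f t < 1 →
      r ≤ t - virtualValue f t / deriv (virtualValue f) t)
    (hw : ∀ i, 0 < p.2 i) (hne : ∀ i, p.1 i ≠ r) (hF : ∀ i, valueCDF f (p.1 i) < 1)
    (h₁ : o₁.IsSNE (proposedRanking r) s p) (h₂ : o₂.IsSNE (standardRanking r) s p)
    {i j : Fin n} (hp : IsReversal r i j p) :
    ∑ i, virtualValue f (p.1 i) * p.2 i * o₂.alloc (standardRanking r) s p.2 i <
      ∑ i, virtualValue f (p.1 i) * p.2 i * o₁.alloc (proposedRanking r) s p.2 i := by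
  obtain ⟨hi, hj, hother, hwij, hstd, hprop⟩ := hp
  have hy₁ := hasReservePrice_proposedRanking r
  have hy₂ := hasReservePrice_standardRanking hr_pos
  have hij : i ≠ j := fun e => by subst e; exact lt_irrefl _ hwij
  have hS0 := slotEffect_zero_pos hm hs_pos
  have hfirst : ∀ (ρ : Equiv.Perm (Fin n)) (a b : Fin n), (ρ a : ℕ) = 0 → b ≠ a → ρ a < ρ b := by
    intro ρ a b ha hab
    have : (ρ b : ℕ) ≠ ρ a := fun e => hab (ρ.injective (Fin.ext e))
    rw [Fin.lt_def]
    omega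
  have hn : 0 < n := (Nat.zero_le _).trans_lt i.is_lt
  have top : ∀ ρ : Equiv.Perm (Fin n), (ρ (ρ.symm ⟨0, hn⟩) : ℕ) = 0 := fun ρ => by simp
  have hcases : ∀ l, r < p.1 l → l = i ∨ l = j := fun l hl => by
    by_contra h
    push Not at h
    exact absurd (hother l h.1 h.2) hl.not_gt
  have htop₁ : (o₁.rank i : ℕ) = 0 := by
    have h0 := top o₁.rank
    rcases hcases _ (h₁.lt_value_of_rank_eq_zero hy₁ hm hs hs_pos hw hne hi h0) with h | h
    · rwa [h] at h0
    · rw [h] at h0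
      have := h₁.proposed_order hs hs_pos hw hne (hfirst _ j i h0 hij) (by rwa [h0])
      rw [proposedRanking, proposedRanking, max_eq_left (sub_nonneg.mpr hi.le),
        max_eq_left (sub_nonneg.mpr hj.le)] at this
      exact absurd hprop this.not_gt
  have htop₂ : (o₂.rank j : ℕ) = 0 := by
    have h0 := top o₂.rank
    rcases hcases _ (h₂.lt_value_of_rank_eq_zero hy₂ hm hs hs_pos hw hne hi h0) with h | h
    · rw [h] at h0
      have := h₂.standard_order hr_pos hs hs_pos hw hi hj (hfirst _ i j h0 hij.symm) (by rwa [h0])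
        hwij.le
      exact absurd hstd this.not_gt
    · rwa [h] at h0
  rw [h₁.sum_virtualValue_eq hy₁ hs_pos hw hne, h₂.sum_virtualValue_eq hy₂ hs_pos hw hne]
  refine sum_mul_rank_lt (slotEffect_antitone hs hs_pos)
    (virtualWeight_le hf hs hs_pos hr_pos hr hw hne hF h₁ h₂)
    (slotEffect_lt hs zero_lt_one hS0) htop₁ htop₂ ?_
  rw [virtualWeight_of_gt hi, virtualWeight_of_gt hj]
  exact hf.virtualValue_mul_lt_mul hr_pos hr hj (hF i) (hw i) hwij.le hprop

end Pointwise

/-! ### Reversals have positive probability -/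

section Reversal

variable {n : ℕ} {f : ℝ → ℝ} {r : ℝ}

lemma measure_isReversal_ne_zero (hf : IsRegularDensity f) (hr : r ∈ valueRange f) {w : Fin n → ℝ}
    (hw : ∀ i, 0 < w i) {i j : Fin n} (hij : w i < w j) :
    Measure.pi (fun _ : Fin n => valueLaw f) {θ | IsReversal r i j (θ, w)} ≠ 0 := by
  have := hf.isProbabilityMeasure
  have hr_pos : 0 < r := hr.1
  have hne : i ≠ j := fun e => by subst e; exact lt_irrefl _ hij
  obtain ⟨b, hb, hb1⟩ : ∃ b, r < b ∧ valueCDF f b < 1 := by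
    obtain ⟨l, u, hlu, hsub⟩ :=
      mem_nhds_iff_exists_Ioo_subset.mp (IsRegularDensity.valueRange_mem_nhds hr)
    obtain ⟨b, hrb, hbu⟩ := exists_between hlu.2
    exact ⟨b, hrb, (hsub ⟨hlu.1.trans hrb, hbu⟩).2⟩
  -- The last condition says (r + ε)w_i < r w_j, so `j` wins under the standard ranking for all
  -- values of `i` below r + ε.
  obtain ⟨ε, hε, hεb, hεw⟩ : ∃ ε, 0 < ε ∧ r + ε ≤ b ∧ ε * w i < r * (w j - w i) := by
    have h1 : 0 < r * (w j - w i) / w i :=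
      div_pos (mul_pos hr_pos (sub_pos.mpr hij)) (hw i)
    obtain ⟨ε, hε, hlt⟩ := exists_between (lt_min (sub_pos.mpr hb) h1)
    refine ⟨ε, hε, by linarith [hlt.le.trans (min_le_left _ _)], ?_⟩
    exact (lt_div_iff₀ (hw i)).mp (hlt.trans_le (min_le_right _ _))
  -- Chosen so that δ w_j = (ε/2) w_i: then `i`, with a value above r + ε/2, wins once `r` is
  -- subtracted.
  set δ := ε / 2 * w i / w j with hδ
  have hδ0 : 0 < δ := div_pos (mul_pos (half_pos hε) (hw i)) (hw j)
  have hδw : δ * w j = ε / 2 * w i := div_mul_cancel₀ _ (hw j).ne'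
  have hδε : δ ≤ ε := by
    rw [hδ, div_le_iff₀ (hw j)]
    nlinarith [hw i, hw j]
  have hbox : Set.univ.pi (fun l => if l = i then Set.Ioo (r + ε / 2) (r + ε)
      else if l = j then Set.Ioo r (r + δ) else Set.Ioo 0 r) ⊆
      {θ : Fin n → ℝ | IsReversal r i j (θ, w)} := by
    intro θ hθ
    have hi : θ i ∈ Set.Ioo (r + ε / 2) (r + ε) := by simpa using hθ i (Set.mem_univ i)
    have hj : θ j ∈ Set.Ioo r (r + δ) := by simpa [hne.symm] using hθ j (Set.mem_univ j)
    refine ⟨?_, hj.1, fun l hli hlj => ?_, hij, ?_, ?_⟩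
    · show r < θ i
      linarith [hi.1]
    · have : θ l ∈ Set.Ioo 0 r := by simpa [hli, hlj] using hθ l (Set.mem_univ l)
      exact this.2
    · show θ i * w i < θ j * w j
      have h1 := mul_lt_mul_of_pos_right hi.2 (hw i)
      have h2 := mul_lt_mul_of_pos_right hj.1 (hw j)
      linarith
    · show (θ j - r) * w j < (θ i - r) * w i
      have h1 := mul_lt_mul_of_pos_right hi.1 (hw i)
      have h2 := mul_lt_mul_of_pos_right hj.2 (hw j)
      linarith
  refine fun h0 => absurd (measure_mono_null hbox h0) ?_
  rw [Measure.pi_pi, ← ne_eq, Finset.prod_ne_zero_iff]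
  intro l _
  have hmono := fun {t : ℝ} (ht : t ≤ b) => (valueCDF_mono f ht).trans_lt hb1
  split_ifs
  · exact (hf.valueLaw_Ioo_pos (by linarith) (by linarith) (hmono hεb)).ne'
  · exact (hf.valueLaw_Ioo_pos hr_pos.le (by linarith) (hmono (by linarith))).ne'
  · exact pos_iff_ne_zero.mp (hf.valueLaw_Ioo_pos le_rfl hr_pos hr.2)

/-- Unless all relevances are equal, reversals occur with positive probability. -/
lemma not_ae_not_isReversal (hf : IsRegularDensity f) (hr : r ∈ valueRange f)
    {ν : Measure (Fin n → ℝ)} [IsProbabilityMeasure ν] (hw_pos : ∀ᵐ w ∂ν, ∀ i, 0 < w i)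
    (hw_ne : ¬ ∀ᵐ w ∂ν, ∀ i j, w i = w j) :
    ¬ ∀ᵐ p ∂typeLaw f ν, ∀ i j, ¬ IsReversal r i j p := by
  have := hf.isProbabilityMeasure
  intro h
  refine hw_ne ?_
  have hswap := Measure.ae_ae_of_ae_prod ((Measure.measurePreserving_swap (μ := ν)
    (ν := Measure.pi fun _ : Fin n => valueLaw f)).quasiMeasurePreserving.ae h)
  filter_upwards [hswap, hw_pos] with w hw hwpos i j
  by_contra hne
  have key : ∀ i j : Fin n, ¬ w i < w j := fun i j hij =>
    measure_isReversal_ne_zero hf hr hwpos hij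
      (measure_eq_zero_iff_ae_notMem.mpr (hw.mono fun θ hθ => hθ i j))
  rcases lt_or_gt_of_ne hne with h | h
  · exact key i j h
  · exact key j i h

end Reversal

section Integrability

variable {n m : ℕ} {s : Fin m → ℝ} {f : ℝ → ℝ} {r : ℝ} {ν : Measure (Fin n → ℝ)}
  {y : ℝ → ℝ → ℝ} {o : Types n → Outcome n}

/-! ### Measurability and integrability -/

lemma IsMeasurableRule.aemeasurable_score {P : Measure (Types n)} (ho : IsMeasurableRule P o)
    (hy : Measurable fun x : ℝ × ℝ => y x.1 x.2) (i : Fin n) :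
    AEMeasurable (fun p => y ((o p).bid i) (p.2 i)) P :=
  hy.comp_aemeasurable ((ho i).1.prodMk (measurable_relevance i).aemeasurable)

lemma IsMeasurableRule.aemeasurable_alloc {P : Measure (Types n)} (ho : IsMeasurableRule P o)
    (hy : Measurable fun x : ℝ × ℝ => y x.1 x.2) (i : Fin n) :
    AEMeasurable (fun p => (o p).alloc y s p.2 i) P := by
  have hg : Measurable fun x : ℝ × Fin n => if 0 < x.1 then slotEffect s x.2 else 0 :=
    Measurable.ite (measurableSet_lt measurable_const measurable_fst)
      ((Measurable.of_discrete (f := fun k : Fin n => slotEffect s k)).comp measurable_snd)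
      measurable_const
  exact hg.comp_aemeasurable ((ho.aemeasurable_score hy i).prodMk (ho i).2)

/-- A finite sum of indicators avoids the inverse permutation and makes measurability visible. -/
lemma Outcome.nextScore_rank_eq (o : Outcome n) (w : Fin n → ℝ) (i : Fin n) :
    o.nextScore y w (o.rank i) =
      ∑ j, if (o.rank j : ℕ) = o.rank i + 1 then y (o.bid j) (w j) else 0 := by
  unfold nextScore
  split_ifs with h
  · rw [Finset.sum_eq_single (o.rank.symm ⟨o.rank i + 1, h⟩)]
    · simp
    · intro j _ hj
      refine if_neg fun e => hj ?_
      rw [Equiv.eq_symm_apply]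
      exact Fin.ext e
    · simp
  · refine (Finset.sum_eq_zero fun j _ => if_neg fun e => h ?_).symm
    rw [← e]
    exact (o.rank j).is_lt

lemma IsMeasurableRule.aemeasurable_nextScore {P : Measure (Types n)} (ho : IsMeasurableRule P o)
    (hy : Measurable fun x : ℝ × ℝ => y x.1 x.2) (i : Fin n) :
    AEMeasurable (fun p => (o p).nextScore y p.2 ((o p).rank i)) P := by
  simp only [Outcome.nextScore_rank_eq]
  refine Finset.aemeasurable_fun_sum _ fun j _ => ?_
  have hset : MeasurableSet {x : (Fin n × Fin n) × ℝ | (x.1.1 : ℕ) = x.1.2 + 1} :=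
    measurable_fst (MeasurableSet.of_discrete (s := {x : Fin n × Fin n | (x.1 : ℕ) = x.2 + 1}))
  have hg : Measurable fun x : (Fin n × Fin n) × ℝ =>
      if (x.1.1 : ℕ) = x.1.2 + 1 then x.2 else 0 :=
    Measurable.ite hset measurable_snd measurable_const
  exact hg.comp_aemeasurable (((ho j).2.prodMk (ho i).2).prodMk (ho.aemeasurable_score hy j))

lemma integrable_value_mul_relevance (hf : IsRegularDensity f) (hr : 0 < r)
    (hw_int : ∀ i, Integrable (fun w : Fin n → ℝ => w i) ν) (i : Fin n) :
    Integrable (fun p : Types n => p.1 i * p.2 i) (typeLaw f ν) := by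
  have := hf.isProbabilityMeasure
  have hmp := measurePreserving_eval (fun _ : Fin n => valueLaw f) i
  exact (hmp.integrable_comp_of_integrable (hf.integrable_id hr)).mul_prod (hw_int i)

variable [IsProbabilityMeasure ν]

lemma integrable_relevance (hf : IsRegularDensity f)
    (hw_int : ∀ i, Integrable (fun w : Fin n → ℝ => w i) ν) (i : Fin n) :
    Integrable (fun p : Types n => p.2 i) (typeLaw f ν) := by
  have := hf.isProbabilityMeasure
  exact (hw_int i).comp_snd _

lemma SelectsSNE.integrable_surplus (hf : IsRegularDensity f) (hs : StrictAnti s)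
    (hs_pos : ∀ k, 0 < s k) (hr : 0 < r) (hw_pos : ∀ᵐ w ∂ν, ∀ i, 0 < w i)
    (hw_int : ∀ i, Integrable (fun w : Fin n → ℝ => w i) ν)
    (hy : Measurable fun x : ℝ × ℝ => y x.1 x.2)
    (ho : SelectsSNE y s (typeLaw f ν) o) (i : Fin n) :
    Integrable (fun p => p.1 i * p.2 i * (o p).alloc y s p.2 i) (typeLaw f ν) := by
  have := hf.isProbabilityMeasure
  refine ((integrable_value_mul_relevance hf hr hw_int i).mul_const (slotEffect s 0)).mono'
    ((((measurable_value i).mul (measurable_relevance i)).aemeasurable.mul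
      (ho.1.aemeasurable_alloc hy i)).aestronglyMeasurable) ?_
  filter_upwards [ae_value (ν := ν) hf.ae_pos, ae_relevance (f := f) hw_pos] with p hθ hw
  have h1 := mul_nonneg (hθ i).le (hw i).le
  rw [Real.norm_of_nonneg (mul_nonneg h1 (Outcome.alloc_nonneg hs_pos i))]
  exact mul_le_mul_of_nonneg_left (Outcome.alloc_le hs hs_pos i) h1

/-- The inverse hazard rate need not be bounded near 0, but values below `r` get no slot, and above
`r` it is at most its value at `r`. -/
lemma SelectsSNE.integrable_inverseHazard (hf : IsRegularDensity f) (hs : StrictAnti s)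
    (hs_pos : ∀ k, 0 < s k) (hr : 0 < r) (hw_pos : ∀ᵐ w ∂ν, ∀ i, 0 < w i)
    (hw_int : ∀ i, Integrable (fun w : Fin n → ℝ => w i) ν)
    (hyr : HasReservePrice y r) (hy : Measurable fun x : ℝ × ℝ => y x.1 x.2)
    (ho : SelectsSNE y s (typeLaw f ν) o) (i : Fin n) :
    Integrable (fun p => inverseHazard f (p.1 i) * p.2 i * (o p).alloc y s p.2 i)
      (typeLaw f ν) := by
  have := hf.isProbabilityMeasure
  refine (((integrable_relevance hf hw_int i).const_mul (inverseHazard f r)).mul_const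
    (slotEffect s 0)).mono' (((((hf.measurable_inverseHazard.comp (measurable_value i)).mul
      (measurable_relevance i)).aemeasurable.mul
      (ho.1.aemeasurable_alloc hy i)).aestronglyMeasurable)) ?_
  filter_upwards [ho.2, ae_relevance (f := f) hw_pos] with p hop hw
  have h1 := mul_nonneg (hf.inverseHazard_nonneg (p.1 i)) (hw i).le
  have h2 := mul_nonneg (hf.inverseHazard_nonneg r) (hw i).le
  have hS0 := slotEffect_nonneg hs_pos 0
  rw [Real.norm_of_nonneg (mul_nonneg h1 (Outcome.alloc_nonneg hs_pos i))]
  rcases lt_or_ge (p.1 i) r with hi | hi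
  · rw [hop.alloc_eq_zero hyr hs_pos hw hi, mul_zero]
    exact mul_nonneg h2 hS0
  · exact mul_le_mul (mul_le_mul_of_nonneg_right (hf.inverseHazard_le hr hi) (hw i).le)
      (Outcome.alloc_le hs hs_pos i) (Outcome.alloc_nonneg hs_pos i) h2

lemma SelectsSNE.integrable_virtualSurplus (hf : IsRegularDensity f) (hs : StrictAnti s)
    (hs_pos : ∀ k, 0 < s k) (hr : 0 < r) (hw_pos : ∀ᵐ w ∂ν, ∀ i, 0 < w i)
    (hw_int : ∀ i, Integrable (fun w : Fin n → ℝ => w i) ν)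
    (hyr : HasReservePrice y r) (hy : Measurable fun x : ℝ × ℝ => y x.1 x.2)
    (ho : SelectsSNE y s (typeLaw f ν) o) :
    Integrable (fun p => ∑ i, virtualValue f (p.1 i) * p.2 i * (o p).alloc y s p.2 i)
      (typeLaw f ν) := by
  refine integrable_finsetSum _ fun i _ => ?_
  refine ((ho.integrable_surplus hf hs hs_pos hr hw_pos hw_int hy i).sub
    (ho.integrable_inverseHazard hf hs hs_pos hr hw_pos hw_int hyr hy i)).congr
    (Filter.Eventually.of_forall fun p => ?_)
  simp only [Pi.sub_apply, virtualValue_eq]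
  ring

lemma SelectsSNE.integrable_utility (hf : IsRegularDensity f) (hs : StrictAnti s)
    (hs_pos : ∀ k, 0 < s k) (hr : 0 < r) (hw_pos : ∀ᵐ w ∂ν, ∀ i, 0 < w i)
    (hw_int : ∀ i, Integrable (fun w : Fin n → ℝ => w i) ν)
    (ho : SelectsSNE (proposedRanking r) s (typeLaw f ν) o) (i : Fin n) :
    Integrable (fun p => (o p).utility (proposedRanking r) s p i) (typeLaw f ν) := by
  have := hf.isProbabilityMeasure
  have hy := measurable_proposedRanking r
  have hyr := hasReservePrice_proposedRanking r
  have hwp := ae_relevance (f := f) hw_pos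
  refine (ho.integrable_surplus hf hs hs_pos hr hw_pos hw_int hy i).mono' ?_ ?_
  · refine AEMeasurable.aestronglyMeasurable (AEMeasurable.congr (f := fun p : Types n =>
      ((p.1 i - r) * p.2 i - (o p).nextScore (proposedRanking r) p.2 ((o p).rank i)) *
        (o p).alloc (proposedRanking r) s p.2 i) ?_ ?_)
    · exact ((((measurable_value i).sub_const r).mul (measurable_relevance i)).aemeasurable.sub
        (ho.1.aemeasurable_nextScore hy i)).mul (ho.1.aemeasurable_alloc hy i)
    · filter_upwards [hwp] with p hw
      exact (Outcome.utility_proposed hw i).symm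
  · filter_upwards [ho.2, hwp] with p hop hw
    rw [Real.norm_of_nonneg (hop.utility_nonneg' hw i), Outcome.utility, sub_mul, sub_mul]
    linarith [Outcome.payment_nonneg (o := o p) (s := s) hyr hr hs_pos hw i]

/-- Under the proposed ranking, every selection of equilibria has at least the revenue of the
optimal Bayes-Nash equilibrium with the same allocation rule. -/
theorem SelectsSNE.virtualSurplus_le_expectedRevenue (hf : IsRegularDensity f) (hs : StrictAnti s)
    (hs_pos : ∀ k, 0 < s k) (hr : 0 < r) (hw_pos : ∀ᵐ w ∂ν, ∀ i, 0 < w i)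
    (hw_int : ∀ i, Integrable (fun w : Fin n → ℝ => w i) ν)
    (ho : SelectsSNE (proposedRanking r) s (typeLaw f ν) o) :
    virtualSurplus f (proposedRanking r) s (typeLaw f ν) o ≤
      expectedRevenue (proposedRanking r) s (typeLaw f ν) o := by
  have := hf.isProbabilityMeasure
  have hy := measurable_proposedRanking r
  have hyr := hasReservePrice_proposedRanking r
  have hwp := ae_relevance (f := f) hw_pos
  have hX := ho.integrable_surplus hf hs hs_pos hr hw_pos hw_int hy
  have hI := ho.integrable_inverseHazard hf hs hs_pos hr hw_pos hw_int hyr hy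
  have hU := ho.integrable_utility hf hs hs_pos hr hw_pos hw_int
  have hV : virtualSurplus f (proposedRanking r) s (typeLaw f ν) o =
      ∑ i, ((∫ p, p.1 i * p.2 i * (o p).alloc (proposedRanking r) s p.2 i ∂typeLaw f ν) -
        ∫ p, inverseHazard f (p.1 i) * p.2 i * (o p).alloc (proposedRanking r) s p.2 i
          ∂typeLaw f ν) := by
    simp only [← integral_sub (hX _) (hI _)]
    refine Eq.trans ?_ (integral_finsetSum _ fun i _ => (hX i).sub (hI i))
    refine integral_congr_ae (Filter.Eventually.of_forall fun p => ?_)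
    refine Finset.sum_congr rfl fun i _ => ?_
    rw [virtualValue_eq]
    ring
  have hR : expectedRevenue (proposedRanking r) s (typeLaw f ν) o =
      ∑ i, ((∫ p, p.1 i * p.2 i * (o p).alloc (proposedRanking r) s p.2 i ∂typeLaw f ν) -
        ∫ p, (o p).utility (proposedRanking r) s p i ∂typeLaw f ν) := by
    simp only [← integral_sub (hX _) (hU _)]
    refine Eq.trans ?_ (integral_finsetSum _ fun i _ => (hX i).sub (hU i))
    refine integral_congr_ae (Filter.Eventually.of_forall fun p => ?_)
    refine Finset.sum_congr rfl fun i _ => ?_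
    rw [Outcome.utility]
    ring
  rw [hV, hR]
  refine Finset.sum_le_sum fun i _ => sub_le_sub_left ?_ _
  have hI0 : 0 ≤ᵐ[typeLaw f ν] fun p => inverseHazard f (p.1 i) * p.2 i *
      (o p).alloc (proposedRanking r) s p.2 i := by
    filter_upwards [hwp] with p hw
    exact mul_nonneg (mul_nonneg (hf.inverseHazard_nonneg _) (hw i).le)
      (Outcome.alloc_nonneg hs_pos i)
  have hU0 : 0 ≤ᵐ[typeLaw f ν] fun p => (o p).utility (proposedRanking r) s p i := by
    filter_upwards [ho.2, hwp] with p hop hw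
    exact hop.utility_nonneg' hw i
  rw [← ENNReal.ofReal_le_ofReal_iff (integral_nonneg_of_ae hI0),
    ofReal_integral_eq_lintegral_ofReal (hU i) hU0, ofReal_integral_eq_lintegral_ofReal (hI i) hI0]
  exact lintegral_utility_le hf hs hs_pos hr hw_pos ho.2 i

/-- The proposed ranking has a larger virtual surplus than the standard one. -/
theorem virtualSurplus_standard_lt_proposed (hm : 0 < m) (hf : IsRegularDensity f)
    (hs : StrictAnti s) (hs_pos : ∀ k, 0 < s k) (hr : r ∈ valueRange f)
    (hr_inf : ∀ t, r ≤ t → valueCDF f t < 1 →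
      r ≤ t - virtualValue f t / deriv (virtualValue f) t)
    (hw_pos : ∀ᵐ w ∂ν, ∀ i, 0 < w i)
    (hw_int : ∀ i, Integrable (fun w : Fin n → ℝ => w i) ν)
    (hw_ne : ¬ ∀ᵐ w ∂ν, ∀ i j, w i = w j) {o₁ o₂ : Types n → Outcome n}
    (h₁ : SelectsSNE (proposedRanking r) s (typeLaw f ν) o₁)
    (h₂ : SelectsSNE (standardRanking r) s (typeLaw f ν) o₂) :
    virtualSurplus f (standardRanking r) s (typeLaw f ν) o₂ <
      virtualSurplus f (proposedRanking r) s (typeLaw f ν) o₁ := by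
  have := hf.isProbabilityMeasure
  have hInt₁ := h₁.integrable_virtualSurplus hf hs hs_pos hr.1 hw_pos hw_int
    (hasReservePrice_proposedRanking r) (measurable_proposedRanking r)
  have hInt₂ := h₂.integrable_virtualSurplus hf hs hs_pos hr.1 hw_pos hw_int
    (hasReservePrice_standardRanking hr.1) (measurable_standardRanking r)
  have hwp := ae_relevance (f := f) hw_pos
  have hne := ae_value (ν := ν) (ae_valueLaw_ne f r)
  have hF := ae_value (ν := ν) hf.ae_valueCDF_lt_one
  have hle : (fun p => ∑ i, virtualValue f (p.1 i) * p.2 i *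
      (o₂ p).alloc (standardRanking r) s p.2 i) ≤ᵐ[typeLaw f ν]
      fun p => ∑ i, virtualValue f (p.1 i) * p.2 i *
        (o₁ p).alloc (proposedRanking r) s p.2 i := by
    filter_upwards [h₁.2, h₂.2, hwp, hne, hF] with p hp₁ hp₂ hw hne hF
    exact sum_virtualValue_le hf hs hs_pos hr.1 hr_inf hw hne hF hp₁ hp₂
  refine lt_of_le_of_ne (integral_mono_ae hInt₂ hInt₁ hle) fun heq => ?_
  refine not_ae_not_isReversal hf hr hw_pos hw_ne ?_
  -- Equal integrals would force equality almost everywhere, which reversals exclude.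
  have heq' := (integral_eq_iff_of_ae_le hInt₂ hInt₁ hle).mp heq
  filter_upwards [heq', h₁.2, h₂.2, hwp, hne, hF] with p hp hp₁ hp₂ hw hne hF i j hrev
  exact (sum_virtualValue_lt hm hf hs hs_pos hr.1 hr_inf hw hne hF hp₁ hp₂ hrev).ne hp

end Integrability

lemma valueCDF_lt_one_of_virtualValue_eq_zero {f : ℝ → ℝ} {t : ℝ} (ht : 0 < t)
    (h : virtualValue f t = 0) : valueCDF f t < 1 := by
  refine lt_of_le_of_ne (valueCDF_le_one f t) fun h1 => ht.ne' ?_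
  simpa [virtualValue, h1] using h

end GSP

end

/-! ### The theorem -/

theorem theorem2 {n m : ℕ} (hm : 0 < m)
    (s : Fin m → ℝ) (hs : StrictAnti s) (hs_pos : ∀ k, 0 < s k)
    (f : ℝ → ℝ) (hf : GSP.IsRegularDensity f)
    (ν : MeasureTheory.Measure (Fin n → ℝ)) [MeasureTheory.IsProbabilityMeasure ν]
    (hw_pos : ∀ᵐ w ∂ν, ∀ i, 0 < w i)
    (hw_int : ∀ i, MeasureTheory.Integrable (fun w : Fin n → ℝ => w i) ν)
    (hw_ne : ¬ ∀ᵐ w ∂ν, ∀ i j, w i = w j)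
    (θbar : ℝ) (hθbar : GSP.virtualValue f θbar = 0)
    (r : ℝ) (hr_pos : 0 < r) (hr_le : r ≤ θbar)
    (hr : ∀ t, r ≤ t → GSP.valueCDF f t < 1 →
      r ≤ t - GSP.virtualValue f t / deriv (GSP.virtualValue f) t)
    (o₂ : GSP.Types n → GSP.Outcome n)
    (h₂ : GSP.SelectsSNE (GSP.standardRanking r) s (GSP.typeLaw f ν) o₂)
    (h₂_bound : GSP.RespectsBound f (GSP.standardRanking r) s (GSP.typeLaw f ν) o₂) :
    (∀ o₁ : GSP.Types n → GSP.Outcome n,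
      GSP.SelectsSNE (GSP.proposedRanking r) s (GSP.typeLaw f ν) o₁ →
      GSP.RespectsBound f (GSP.proposedRanking r) s (GSP.typeLaw f ν) o₁ →
        GSP.expectedRevenue (GSP.standardRanking r) s (GSP.typeLaw f ν) o₂ <
          GSP.expectedRevenue (GSP.proposedRanking r) s (GSP.typeLaw f ν) o₁) ∧
    (∀ o₁ : GSP.Types n → GSP.Outcome n,
      GSP.SelectsLowestSNE (GSP.proposedRanking r) s (GSP.typeLaw f ν) o₁ →
        GSP.expectedRevenue (GSP.standardRanking r) s (GSP.typeLaw f ν) o₂ <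
          GSP.expectedRevenue (GSP.proposedRanking r) s (GSP.typeLaw f ν) o₁) := by
  -- The zero of φ serves to place `r` strictly inside the range of the values: F(θbar) = 1 would
  -- give φ(θbar) = θbar > 0.
  have hr_mem : r ∈ GSP.valueRange f :=
    ⟨hr_pos, (GSP.valueCDF_mono f hr_le).trans_lt
      (GSP.valueCDF_lt_one_of_virtualValue_eq_zero (hr_pos.trans_le hr_le) hθbar)⟩
  have key : ∀ o₁ : GSP.Types n → GSP.Outcome n,
      GSP.SelectsSNE (GSP.proposedRanking r) s (GSP.typeLaw f ν) o₁ →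
        GSP.expectedRevenue (GSP.standardRanking r) s (GSP.typeLaw f ν) o₂ <
          GSP.expectedRevenue (GSP.proposedRanking r) s (GSP.typeLaw f ν) o₁ := fun o₁ h₁ =>
    calc GSP.expectedRevenue (GSP.standardRanking r) s (GSP.typeLaw f ν) o₂
        ≤ GSP.virtualSurplus f (GSP.standardRanking r) s (GSP.typeLaw f ν) o₂ := h₂_bound
      _ < GSP.virtualSurplus f (GSP.proposedRanking r) s (GSP.typeLaw f ν) o₁ :=
        GSP.virtualSurplus_standard_lt_proposed hm hf hs hs_pos hr_mem hr hw_pos hw_int hw_ne h₁ h₂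
      _ ≤ _ := h₁.virtualSurplus_le_expectedRevenue hf hs hs_pos hr_pos hw_pos hw_int
  exact ⟨fun o₁ h₁ _ => key o₁ h₁,
    fun o₁ h₁ => key o₁ ⟨h₁.1, h₁.2.mono fun _ hp => hp.1⟩⟩
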